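/- For $n\in\mathbb N$ and $p\in[0,1]$ let $G_{n,p}$ denote the random graph on $n$ labelled vertices in which each of the $\binom n2$ possible edges is present independently with probability $p$. For a finite graph $G$ let $\mathrm{ccl}(G)$ denote the largest $k$ such that $G$ contains the complete graph $K_k$ as a minor, i.e. such that there are $k$ pairwise disjoint non-empty vertex sets of $G$, each inducing a connected subgraph of $G$, with at least one edge of $G$ between any two of them. Theorem. For every real number $c>1$ there exists a constant $\delta=\delta(c)>0$ such that $$\lim_{n\to\infty}\Pr\left[\,\delta\sqrt n\le \mathrm{ccl}(G_{n,c/n})\le 2\sqrt{cn}\,\right]=1 .$$ -/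

import Mathlib

namespace SimpleGraph

/-- `H` is a minor of `G`: there are pairwise disjoint branch sets `B h ⊆ V(G)`, one for each
vertex `h` of `H`, each inducing a connected (in particular nonempty) subgraph of `G`, such that
`G` has an edge between `B h` and `B h'` whenever `hh'` is an edge of `H`. -/
def IsMinor {W V : Type*} (H : SimpleGraph W) (G : SimpleGraph V) : Prop :=
  ∃ B : W → Set V,
    (∀ h, (G.induce (B h)).Connected) ∧
    (∀ h h', h ≠ h' → Disjoint (B h) (B h')) ∧
    (∀ h h', H.Adj h h' → ∃ x ∈ B h, ∃ y ∈ B h', G.Adj x y)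

/-- The contraction clique number of a finite graph: the largest `k` such that the complete graph
on `k` vertices is a minor of `G`. -/
noncomputable def ccl {V : Type*} [Finite V] (G : SimpleGraph V) : ℕ :=
  sSup {k : ℕ | IsMinor (completeGraph (Fin k)) G}

theorem IsMinor.le_card {V : Type*} [Finite V] {G : SimpleGraph V} {k : ℕ}
    (hk : IsMinor (completeGraph (Fin k)) G) : k ≤ Nat.card V := by
  obtain ⟨B, hconn, hdisj, -⟩ := hk
  have hne : ∀ i, ∃ x, x ∈ B i := fun i => by
    obtain ⟨x⟩ := (hconn i).nonempty
    exact ⟨x.1, x.2⟩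
  choose f hf using hne
  have hinj : Function.Injective f := by
    intro i j hij
    by_contra hn
    exact Set.disjoint_left.1 (hdisj i j hn) (hf i) (hij ▸ hf j)
  simpa using Nat.card_le_card_of_injective f hinj

/-- The supremum in the definition of `ccl` is a maximum. -/
theorem isGreatest_ccl {V : Type*} [Finite V] (G : SimpleGraph V) :
    IsGreatest {k : ℕ | IsMinor (completeGraph (Fin k)) G} (ccl G) := by
  have hb : BddAbove {k : ℕ | IsMinor (completeGraph (Fin k)) G} :=
    ⟨Nat.card V, fun k hk => IsMinor.le_card hk⟩
  have h0 : {k : ℕ | IsMinor (completeGraph (Fin k)) G}.Nonempty :=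
    ⟨0, fun i => i.elim0, fun i => i.elim0, fun i => i.elim0, fun i => i.elim0⟩
  exact ⟨Nat.sSup_mem h0 hb, fun k hk => le_csSup hb hk⟩

/-- The edge probability `c / n`, truncated to `[0, 1]`; it equals `c / n` as soon as
`0 ≤ c ≤ n` and `0 < n`, which is all that matters as `n → ∞`. -/
noncomputable def sparseEdgeProb (c : ℝ) (n : ℕ) : unitInterval :=
  Set.projIcc (0 : ℝ) 1 zero_le_one (c / n)

end SimpleGraph

/-! The upper bound counts edges. A `K_k` minor needs `k(k-1)/2` edges, about `2cn` when `k >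
2√(cn)`, while the graph has only about `cn/2`; an exponential moment estimate
(`bernP_le_card_edges`) excludes this excess.

The lower bound exposes the graph in two independent rounds, of densities `(1+ε)/n` and about `γ/n`,
whose union has density `c/n` (`bernE_or`). Depth-first search on the first round
(`bernP_not_hasPath_le_of_state`) yields a path with linearly many vertices: if no long path
appeared, the stack would stay short, so the many positive answers would force many finished
vertices, and all pairs from finished to untouched vertices would already have been queried, which
is more than the number of queries made.

An initial stretch of this path is cut into `k ≈ η√n` blocks of `b ≈ √n` vertices, and the rest is
used to join blocks with second-round edges (`bernP_not_joinable_le`). With `f` pairs of blocks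
still unjoined, take the next `2s` path vertices, `s ≈ 1/(pb√f)`. Each half hits a given block with
probability about `1/√f`, so a second moment argument (`one_div_le_bernP_exists_hits`) shows that,
with probability bounded below, the halves hit the two blocks of some open pair. The piece is
connected, so absorbing it into one of these blocks joins them. The second moment needs no block to
lie in more than about `√f` open pairs; a block violating this is discarded, which lowers `√f` by at
least 2, so at most half the blocks are lost. The path length consumed is about `∑ 1/(pb√f) ≈
√|F|/(pb)`, up to constants, which is a small multiple of `n`. The induction uses `exp(2√|F| -
|l|pb/1280)` as a potential bounding the failure probability.

Everything is computed with finite Bernoulli sums; `binomialRandom_eq_ofReal_bernP` transfers the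
result to the random graph measure. -/

/-! ### Finite products of Bernoulli distributions -/

section BernoulliProduct

open Finset

variable {E : Type*} [Fintype E]

/-- The probability of the outcome `ω` when the coordinates `e` are independently `true` with
probability `r e`. -/
def bernWeight (r : E → ℝ) (ω : E → Bool) : ℝ := ∏ e, if ω e then r e else 1 - r e

theorem bernWeight_nonneg {r : E → ℝ} (h0 : ∀ e, 0 ≤ r e) (h1 : ∀ e, r e ≤ 1) (ω : E → Bool) :
    0 ≤ bernWeight r ω := by
  refine prod_nonneg fun e _ => ?_
  split_ifs
  · exact h0 e
  · linarith [h1 e]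

/-- An already exposed edge is modelled by setting its probability to 0 or 1; this recovers the
exposed value on outcomes of positive weight. -/
theorem eq_true_of_bernWeight_ne_zero {r : E → ℝ} {ω : E → Bool} (h : bernWeight r ω ≠ 0)
    {e : E} (he : r e = 1) : ω e = true := by
  by_contra hc
  exact h (prod_eq_zero (mem_univ e) (by simp [hc, he]))

variable [DecidableEq E]

/-- The expectation of `f` when the coordinates `e` are independently `true` with
probability `r e`. -/
def bernE (r : E → ℝ) (f : (E → Bool) → ℝ) : ℝ := ∑ ω, bernWeight r ω * f ω

open Classical in
/-- The probability of `A` when the coordinates `e` are independently `true` with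
probability `r e`. -/
noncomputable def bernP (r : E → ℝ) (A : (E → Bool) → Prop) : ℝ :=
  bernE r fun ω => if A ω then 1 else 0

theorem bernE_prod (r : E → ℝ) (g : E → Bool → ℝ) :
    bernE r (fun ω => ∏ e, g e (ω e)) = ∏ e, (r e * g e true + (1 - r e) * g e false) := by
  have h := Finset.prod_univ_sum (fun _ : E => (univ : Finset Bool))
    (fun e b => (if b then r e else 1 - r e) * g e b)
  simp only [Fintype.sum_bool, Fintype.piFinset_univ, if_true, Bool.false_eq_true, if_false] at h
  rw [h]
  simp only [bernE, bernWeight, Finset.prod_mul_distrib]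

theorem bernE_const (r : E → ℝ) (c : ℝ) : bernE r (fun _ => c) = c := by
  have h := bernE_prod r (fun _ _ => 1)
  simp only [bernE, prod_const_one, mul_one, add_sub_cancel] at h
  simp only [bernE, ← Finset.sum_mul, h, one_mul]

theorem bernE_add (r : E → ℝ) (f g : (E → Bool) → ℝ) :
    bernE r (fun ω => f ω + g ω) = bernE r f + bernE r g := by
  simp only [bernE, mul_add, sum_add_distrib]

theorem bernE_sub (r : E → ℝ) (f g : (E → Bool) → ℝ) :
    bernE r (fun ω => f ω - g ω) = bernE r f - bernE r g := by
  simp only [bernE, mul_sub, sum_sub_distrib]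

theorem bernE_const_mul (r : E → ℝ) (c : ℝ) (f : (E → Bool) → ℝ) :
    bernE r (fun ω => c * f ω) = c * bernE r f := by
  simp only [bernE, Finset.mul_sum]
  exact sum_congr rfl fun _ _ => by ring

theorem bernE_sum {ι : Type*} (r : E → ℝ) (s : Finset ι) (f : ι → (E → Bool) → ℝ) :
    bernE r (fun ω => ∑ i ∈ s, f i ω) = ∑ i ∈ s, bernE r (f i) := by
  simp only [bernE, Finset.mul_sum]
  exact sum_comm

theorem bernE_mono_ae {r : E → ℝ} (h0 : ∀ e, 0 ≤ r e) (h1 : ∀ e, r e ≤ 1)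
    {f g : (E → Bool) → ℝ} (h : ∀ ω, bernWeight r ω ≠ 0 → f ω ≤ g ω) : bernE r f ≤ bernE r g := by
  refine sum_le_sum fun ω _ => ?_
  by_cases hw : bernWeight r ω = 0
  · simp [hw]
  · exact mul_le_mul_of_nonneg_left (h ω hw) (bernWeight_nonneg h0 h1 ω)

theorem bernE_mono {r : E → ℝ} (h0 : ∀ e, 0 ≤ r e) (h1 : ∀ e, r e ≤ 1)
    {f g : (E → Bool) → ℝ} (h : ∀ ω, f ω ≤ g ω) : bernE r f ≤ bernE r g :=
  bernE_mono_ae h0 h1 fun ω _ => h ω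

theorem bernP_mono_ae {r : E → ℝ} (h0 : ∀ e, 0 ≤ r e) (h1 : ∀ e, r e ≤ 1)
    {A B : (E → Bool) → Prop} (h : ∀ ω, bernWeight r ω ≠ 0 → A ω → B ω) :
    bernP r A ≤ bernP r B := by
  refine bernE_mono_ae h0 h1 fun ω hw => ?_
  have := h ω hw
  split_ifs <;> simp_all

theorem bernP_nonneg {r : E → ℝ} (h0 : ∀ e, 0 ≤ r e) (h1 : ∀ e, r e ≤ 1)
    (A : (E → Bool) → Prop) : 0 ≤ bernP r A := by
  rw [← bernE_const r 0]
  refine bernE_mono h0 h1 fun ω => ?_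
  split_ifs <;> simp

theorem bernP_le_one {r : E → ℝ} (h0 : ∀ e, 0 ≤ r e) (h1 : ∀ e, r e ≤ 1)
    (A : (E → Bool) → Prop) : bernP r A ≤ 1 := by
  rw [← bernE_const r 1]
  refine bernE_mono h0 h1 fun ω => ?_
  split_ifs <;> simp

theorem bernP_not (r : E → ℝ) (A : (E → Bool) → Prop) :
    bernP r (fun ω => ¬ A ω) = 1 - bernP r A := by
  have h : bernE r (fun _ => (1 : ℝ)) = 1 := bernE_const r 1
  rw [bernP, bernP, ← h, ← bernE_sub]
  refine congrArg _ (funext fun ω => ?_)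
  by_cases hA : A ω <;> simp [hA, h]

theorem bernP_or_le {r : E → ℝ} (h0 : ∀ e, 0 ≤ r e) (h1 : ∀ e, r e ≤ 1)
    (A B : (E → Bool) → Prop) : bernP r (fun ω => A ω ∨ B ω) ≤ bernP r A + bernP r B := by
  rw [bernP, bernP, bernP, ← bernE_add]
  refine bernE_mono h0 h1 fun ω => ?_
  by_cases hA : A ω <;> by_cases hB : B ω <;> simp [hA, hB]

/-- Conditioning on a single coordinate. -/
theorem bernE_split (r : E → ℝ) (f : (E → Bool) → ℝ) (e : E) :
    bernE r f = r e * bernE (Function.update r e 1) f +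
      (1 - r e) * bernE (Function.update r e 0) f := by
  have key : ∀ ω, bernWeight r ω = r e * bernWeight (Function.update r e 1) ω +
      (1 - r e) * bernWeight (Function.update r e 0) ω := by
    intro ω
    have aux : ∀ t : ℝ, bernWeight (Function.update r e t) ω =
        (if ω e then t else 1 - t) * ∏ x ∈ univ.erase e, if ω x then r x else 1 - r x := by
      intro t
      rw [bernWeight, ← mul_prod_erase univ _ (mem_univ e)]
      simp only [Function.update_self]
      congr 1
      refine prod_congr rfl fun x hx => ?_
      rw [Function.update_of_ne (ne_of_mem_erase hx)]
    have h := aux (r e)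
    rw [Function.update_eq_self] at h
    rw [h, aux 1, aux 0]
    split_ifs <;> ring
  simp only [bernE, key, add_mul, sum_add_distrib, Finset.mul_sum, mul_assoc]

theorem bernP_split (r : E → ℝ) (A : (E → Bool) → Prop) (e : E) :
    bernP r A = r e * bernP (Function.update r e 1) A +
      (1 - r e) * bernP (Function.update r e 0) A :=
  bernE_split r _ e

/-- Sampling the success probabilities first. -/
theorem bernE_bernE (r : E → ℝ) (q : E → Bool → ℝ) (f : (E → Bool) → ℝ) :
    bernE r (fun ω => bernE (fun e => q e (ω e)) f) =
      bernE (fun e => r e * q e true + (1 - r e) * q e false) f := by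
  have h : ∀ η, bernE r (fun ω => bernWeight (fun e => q e (ω e)) η) =
      bernWeight (fun e => r e * q e true + (1 - r e) * q e false) η := by
    intro η
    refine (bernE_prod r fun e b => if η e then q e b else 1 - q e b).trans ?_
    refine prod_congr rfl fun e _ => ?_
    split_ifs <;> ring
  have h2 : bernE r (fun ω => bernE (fun e => q e (ω e)) f) =
      ∑ η, bernE r (fun ω => f η * bernWeight (fun e => q e (ω e)) η) := by
    rw [← bernE_sum]
    refine congrArg _ (funext fun ω => ?_)
    exact sum_congr rfl fun η _ => mul_comm _ _
  rw [h2]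
  refine sum_congr rfl fun η _ => ?_
  rw [bernE_const_mul, h, mul_comm]

/-- Combining two independent samples coordinatewise. -/
theorem bernE_map₂ (r₁ r₂ : E → ℝ) (φ : E → Bool → Bool → Bool) (f : (E → Bool) → ℝ) :
    bernE r₁ (fun ω₁ => bernE r₂ (fun ω₂ => f fun e => φ e (ω₁ e) (ω₂ e))) =
      bernE (fun e => r₁ e * (r₂ e * (φ e true true).toNat + (1 - r₂ e) * (φ e true false).toNat) +
        (1 - r₁ e) * (r₂ e * (φ e false true).toNat + (1 - r₂ e) * (φ e false false).toNat)) f := by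
  rw [← bernE_bernE r₁ (fun e b => r₂ e * (φ e b true).toNat + (1 - r₂ e) * (φ e b false).toNat) f]
  refine congrArg _ (funext fun ω₁ => ?_)
  rw [← bernE_bernE r₂ (fun e b => ((φ e (ω₁ e) b).toNat : ℝ)) f]
  refine congrArg _ (funext fun ω₂ => ?_)
  -- With all probabilities equal to 0 or 1, the product distribution is a point mass.
  rw [bernE, sum_eq_single (fun e => φ e (ω₁ e) (ω₂ e))]
  · rw [bernWeight, prod_eq_one, one_mul]
    intro e _
    cases φ e (ω₁ e) (ω₂ e) <;> simp
  · intro η _ hη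
    obtain ⟨e, he⟩ := Function.ne_iff.1 hη
    rw [bernWeight, prod_eq_zero (mem_univ e), zero_mul]
    cases h : φ e (ω₁ e) (ω₂ e) <;> simp_all
  · simp

/-- The union of two independent samples. -/
theorem bernE_or (r₁ r₂ : E → ℝ) (f : (E → Bool) → ℝ) :
    bernE r₁ (fun ω₁ => bernE r₂ (fun ω₂ => f fun e => ω₁ e || ω₂ e)) =
      bernE (fun e => r₁ e + (1 - r₁ e) * r₂ e) f := by
  rw [bernE_map₂ r₁ r₂ (fun _ a b => a || b) f]
  refine congrArg (fun r => bernE r f) (funext fun e => ?_)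
  simp

/-- Exposing the coordinates in `A` first. -/
theorem bernE_expose (r : E → ℝ) (A : Finset E) (f : (E → Bool) → ℝ) :
    bernE r f =
      bernE r (fun ω => bernE (fun e => if e ∈ A then ((ω e).toNat : ℝ) else r e) f) := by
  rw [bernE_bernE r (fun e b => if e ∈ A then (b.toNat : ℝ) else r e) f]
  refine congrArg (fun r => bernE r f) (funext fun e => ?_)
  by_cases h : e ∈ A <;> simp [h]
  ring

/-- Taking the coordinates in `A` from one sample and the others from an independent sample gives
again a sample of law `r`; `f` then sees only the first sample and `g` only the second. -/
theorem bernE_mul_of_dependsOn (r : E → ℝ) {f g : (E → Bool) → ℝ} {A B : Set E}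
    (hAB : Disjoint A B) (hf : DependsOn f A) (hg : DependsOn g B) :
    bernE r (fun ω => f ω * g ω) = bernE r f * bernE r g := by
  classical
  have h := bernE_map₂ r r (fun e a b => if e ∈ A then a else b) (fun ω => f ω * g ω)
  have hr : (fun e => r e * (r e * ((if e ∈ A then true else true : Bool).toNat : ℝ) +
      (1 - r e) * ((if e ∈ A then true else false : Bool).toNat : ℝ)) +
      (1 - r e) * (r e * ((if e ∈ A then false else true : Bool).toNat : ℝ) +
        (1 - r e) * ((if e ∈ A then false else false : Bool).toNat : ℝ))) = r := by
    funext e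
    by_cases he : e ∈ A <;> simp [he]
    ring
  rw [hr] at h
  rw [← h, mul_comm (bernE r f), ← bernE_const_mul]
  refine congrArg _ (funext fun ω₁ => ?_)
  rw [mul_comm, ← bernE_const_mul]
  refine congrArg _ (funext fun ω₂ => ?_)
  congr 1
  · exact hf fun e he => by simp [he]
  · exact hg fun e he => by simp [Set.disjoint_right.1 hAB he]

end BernoulliProduct

/-! ### Long paths by depth-first search -/

section LongPath

open Finset

variable {V : Type*}

/-- The graph whose edges are the non-diagonal pairs marked `true`. -/
def boolGraph (ω : Sym2 V → Bool) : SimpleGraph V := SimpleGraph.fromEdgeSet {e | ω e = true}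

theorem boolGraph_adj {ω : Sym2 V → Bool} {x y : V} :
    (boolGraph ω).Adj x y ↔ ω s(x, y) = true ∧ x ≠ y := by
  simp [boolGraph]

/-- `G` contains a path with at least `ℓ` vertices. -/
def HasPath (G : SimpleGraph V) (ℓ : ℕ) : Prop :=
  ∃ l : List V, l.Nodup ∧ l.IsChain G.Adj ∧ ℓ ≤ l.length

theorem card_mul_card_le_of_pairs {S T : Finset V} {Q : Finset (Sym2 V)} (hST : Disjoint S T)
    (h : ∀ x ∈ S, ∀ y ∈ T, s(x, y) ∈ Q) : S.card * T.card ≤ Q.card := by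
  rw [← card_product]
  refine card_le_card_of_injOn (fun z => s(z.1, z.2)) ?_ ?_
  · rintro ⟨x, y⟩ hz
    simp only [coe_product, Set.mem_prod, mem_coe] at hz
    exact h x hz.1 y hz.2
  · rintro ⟨x, y⟩ hz ⟨x', y'⟩ hz' he
    simp only [coe_product, Set.mem_prod, mem_coe] at hz hz'
    simp only [Sym2.eq_iff] at he
    rcases he with ⟨h1, h2⟩ | ⟨h1, -⟩
    · simp [h1, h2]
    · exact absurd (h1 ▸ hz.1) (disjoint_right.1 hST hz'.2)

variable [Fintype V] [DecidableEq V]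

/-- A depth-first search in state `(Q, U, S, T)`, with queried pairs `Q`, stack `U`, finished
vertices `S`, untouched vertices `T`, and at least `a` positive answers so far, most likely
produces a long path within `N` queries. -/
theorem bernP_not_hasPath_le_of_state {p t : ℝ} (hp0 : 0 ≤ p) (hp1 : p ≤ 1) (ht : 0 ≤ t)
    {n N ℓ x σ : ℕ} (hz : ∀ z, x - ℓ ≤ z → z ≤ σ + 1 → N < z * (n - z - ℓ)) (hxσ : x ≤ ℓ + σ + 1)
    (m : ℕ) : ∀ (r : Sym2 V → ℝ) (Q : Finset (Sym2 V)) (U : List V) (S T : Finset V) (a : ℕ),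
    N - Q.card + 2 * T.card + U.length < m →
    (∀ e, 0 ≤ r e) → (∀ e, r e ≤ 1) → (∀ e ∉ Q, r e = p) → Q.card ≤ N → U.Nodup →
    U.IsChain (fun x y => r s(x, y) = 1) → (∀ v ∈ U, v ∉ T) → (∀ v ∈ U, v ∉ S) → Disjoint S T →
    S.card + U.length + T.card = n → (∀ x ∈ S, ∀ y ∈ T, s(x, y) ∈ Q) → a ≤ S.card + U.length →
    S.card ≤ σ →
    bernP r (fun ω => ¬ HasPath (boolGraph ω) ℓ) ≤
      Real.exp (t * (x - a)) * (1 - p + p * Real.exp (-t)) ^ (N - Q.card) := by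
  -- The measure drops at every move: a query lowers `N - |Q|`, a push trades two units of `T` for
  -- one of `U`, and a pop shortens `U`.
  induction m with
  | zero => intro _ _ _ _ _ _ h; omega
  | succ m ih =>
    intro r Q U S T a hm hr0 hr1 hQ hQN hU hUc hUT hUS hST hcard hSTQ ha hSσ
    have hM : 0 ≤ 1 - p + p * Real.exp (-t) := by
      have := mul_nonneg hp0 (Real.exp_pos (-t)).le
      linarith
    -- Consecutive stack vertices are joined by edges of probability one, so a stack of `ℓ` vertices
    -- is the desired path and failure has probability zero.
    by_cases hlen : ℓ ≤ U.length
    · refine le_trans ?_ (mul_nonneg (Real.exp_pos _).le (pow_nonneg hM _))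
      have h0 : bernE r (fun _ => (0 : ℝ)) = 0 := bernE_const r 0
      rw [← h0]
      refine bernE_mono_ae hr0 hr1 fun ω hω => ?_
      rw [if_neg]
      rw [not_not]
      refine ⟨U, hU, ?_, hlen⟩
      rw [List.isChain_iff_getElem] at hUc ⊢
      intro i hi
      refine boolGraph_adj.2 ⟨eq_true_of_bernWeight_ne_zero hω (hUc i hi), fun h => ?_⟩
      have := (hU.getElem_inj_iff).1 h
      omega
    push Not at hlen
    have hprod := card_mul_card_le_of_pairs hST hSTQ
    have hT : n - S.card - ℓ ≤ T.card := by omega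
    rcases Nat.lt_or_ge Q.card N with hlt | hge
    swap
    -- The queries are exhausted. With `a ≥ x`, a stack shorter than `ℓ` would leave at least `x -
    -- ℓ` finished vertices, and `hz` would give more than `N` queried pairs. Hence `a < x`, and the
    -- claimed bound is at least 1.
    · have hax : a < x := by
        by_contra hax
        push Not at hax
        have h1 := hz S.card (by omega) (by omega)
        have h2 := Nat.mul_le_mul_left S.card hT
        omega
      have hQ' : N - Q.card = 0 := by omega
      rw [hQ', pow_zero, mul_one]
      refine (bernP_le_one hr0 hr1 _).trans (Real.one_le_exp (mul_nonneg ht ?_))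
      have : (a : ℝ) ≤ x := by exact_mod_cast hax.le
      linarith
    have hx0 : 0 < x - ℓ := by
      by_contra h
      have := hz 0 (by omega) (by omega)
      omega
    cases U with
    | nil =>
      -- Otherwise all `n` vertices are finished, so `n ≤ σ`, and `hz` at `σ + 1` has a vanishing
      -- right-hand side.
      have hTne : T.Nonempty := by
        rw [Finset.nonempty_iff_ne_empty]
        rintro rfl
        simp only [List.length_nil, add_zero, card_empty] at hcard
        have := hz (σ + 1) (by omega) le_rfl
        have h2 : n - (σ + 1) - ℓ = 0 := by omega
        rw [h2] at this
        omega
      obtain ⟨v, hv⟩ := hTne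
      have hc := card_erase_of_mem hv
      have hpos := card_pos.2 ⟨v, hv⟩
      refine ih r Q [v] S (T.erase v) a ?_ hr0 hr1 hQ hQN (by simp) (by simp) (by simp) ?_
        (hST.mono_right (erase_subset _ _)) ?_ (fun x hx y hy => hSTQ x hx y (mem_of_mem_erase hy))
        (by simp only [List.length_nil, List.length_singleton] at *; omega) hSσ
      · simp only [List.length_nil, List.length_singleton] at *; omega
      · intro w hw
        rw [List.mem_singleton] at hw
        subst hw
        exact disjoint_right.1 hST hv
      · simp only [List.length_nil, List.length_singleton] at *; omega
    | cons u U =>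
      by_cases hex : ∃ v ∈ T, s(u, v) ∉ Q
      · obtain ⟨v, hv, hvQ⟩ := hex
        set e := s(u, v) with he
        have hc := card_erase_of_mem hv
        have hpos := card_pos.2 ⟨v, hv⟩
        have hcQ := card_insert_of_notMem hvQ
        have hupd0 : ∀ c : ℝ, 0 ≤ c → ∀ e', 0 ≤ Function.update r e c e' := by
          intro c hc e'
          rcases eq_or_ne e' e with rfl | hne
          · simpa using hc
          · simpa [Function.update_of_ne hne] using hr0 e'
        have hupd1 : ∀ c : ℝ, c ≤ 1 → ∀ e', Function.update r e c e' ≤ 1 := by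
          intro c hc e'
          rcases eq_or_ne e' e with rfl | hne
          · simpa using hc
          · simpa [Function.update_of_ne hne] using hr1 e'
        have hupdQ : ∀ c : ℝ, ∀ e' ∉ insert e Q, Function.update r e c e' = p := by
          intro c e' he'
          rw [mem_insert, not_or] at he'
          rw [Function.update_of_ne he'.1, hQ e' he'.2]
        have hupdU : ∀ c : ℝ, (u :: U).IsChain
            (fun x y => Function.update r e c s(x, y) = 1) := by
          intro c
          have hvU : v ∉ u :: U := fun h => hUT v h hv
          refine hUc.imp_of_mem_imp fun x y hx hy hxy => ?_
          rw [Function.update_of_ne, hxy]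
          intro h
          rw [he, Sym2.eq_iff] at h
          rcases h with ⟨-, rfl⟩ | ⟨rfl, -⟩
          · exact hvU hy
          · exact hvU hx
        have hpos_step := ih (Function.update r e 1) (insert e Q) (v :: u :: U) S (T.erase v)
          (a + 1) (by simp only [List.length_cons] at *; omega) (hupd0 1 zero_le_one)
          (hupd1 1 le_rfl) (hupdQ 1) (by omega)
          (List.nodup_cons.2 ⟨fun h => hUT v h hv, hU⟩)
          (List.isChain_cons_cons.2 ⟨by rw [Sym2.eq_swap, ← he, Function.update_self], hupdU 1⟩)
          (by
            intro w hw
            rcases List.mem_cons.1 hw with rfl | hw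
            · simp
            · exact fun h => hUT w hw (mem_of_mem_erase h))
          (by
            intro w hw
            rcases List.mem_cons.1 hw with rfl | hw
            · exact disjoint_right.1 hST hv
            · exact hUS w hw)
          (hST.mono_right (erase_subset _ _)) (by simp only [List.length_cons] at *; omega)
          (fun x hx y hy => mem_insert_of_mem (hSTQ x hx y (mem_of_mem_erase hy)))
          (by simp only [List.length_cons] at *; omega) hSσ
        have hneg_step := ih (Function.update r e 0) (insert e Q) (u :: U) S T a (by omega)
          (hupd0 0 le_rfl) (hupd1 0 zero_le_one) (hupdQ 0) (by omega) hU (hupdU 0) hUT hUS hST hcard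
          (fun x hx y hy => mem_insert_of_mem (hSTQ x hx y hy)) ha hSσ
        -- Averaging over the answer: a positive one gains the factor `exp (-t)`, so the two cases
        -- together give one factor `1 - p + p * exp (-t)`.
        rw [bernP_split r _ e, hQ e hvQ]
        have hexp : N - Q.card = N - (insert e Q).card + 1 := by omega
        have hlam : Real.exp (t * (x - (a + 1 : ℕ))) = Real.exp (t * (x - a)) * Real.exp (-t) := by
          rw [← Real.exp_add]
          congr 1
          push_cast
          ring
        rw [hlam] at hpos_step
        rw [hexp, pow_succ]
        have h1 := mul_le_mul_of_nonneg_left hpos_step hp0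
        have h2 := mul_le_mul_of_nonneg_left hneg_step (sub_nonneg.2 hp1)
        refine (add_le_add h1 h2).trans (le_of_eq ?_)
        ring
      -- All pairs from the top vertex `u` to `T` have been queried, so `u` is finished and popped.
      · push Not at hex
        have huS : u ∉ S := hUS u List.mem_cons_self
        have huT : u ∉ T := hUT u List.mem_cons_self
        have hcS := card_insert_of_notMem huS
        rw [List.nodup_cons] at hU
        have hSTQ' : ∀ x ∈ insert u S, ∀ y ∈ T, s(x, y) ∈ Q := by
          intro x hx y hy
          rcases mem_insert.1 hx with rfl | hx
          · exact hex y hy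
          · exact hSTQ x hx y hy
        have hST' : Disjoint (insert u S) T := disjoint_insert_left.2 ⟨huT, hST⟩
        have hprod' := card_mul_card_le_of_pairs hST' hSTQ'
        simp only [List.length_cons] at *
        refine ih r Q U (insert u S) T a (by omega) hr0 hr1 hQ hQN hU.2 hUc.tail
          (fun w hw => hUT w (List.mem_cons_of_mem _ hw)) ?_ hST' (by omega) hSTQ' (by omega) ?_
        · intro w hw hw'
          rcases mem_insert.1 hw' with rfl | hw'
          · exact hU.1 hw
          · exact hUS w (List.mem_cons_of_mem _ hw) hw'
        -- `S` grows by one vertex at a time, so exceeding `σ` would mean size exactly `σ + 1`,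
        -- which `hz` excludes.
        · by_contra hgt
          have hSeq : (insert u S).card = σ + 1 := by omega
          have h1 := hz (σ + 1) (by omega) le_rfl
          have h2 : n - (σ + 1) - ℓ ≤ T.card := by omega
          have h3 := Nat.mul_le_mul_left (σ + 1) h2
          rw [hSeq] at hprod'
          omega

theorem bernP_not_hasPath_le {p t : ℝ} (hp0 : 0 ≤ p) (hp1 : p ≤ 1) (ht : 0 ≤ t)
    {N ℓ x σ : ℕ} (hz : ∀ z, x - ℓ ≤ z → z ≤ σ + 1 → N < z * (Fintype.card V - z - ℓ))
    (hxσ : x ≤ ℓ + σ + 1) :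
    bernP (fun _ : Sym2 V => p) (fun ω => ¬ HasPath (boolGraph ω) ℓ) ≤
      Real.exp (t * x) * (1 - p + p * Real.exp (-t)) ^ N := by
  have h := bernP_not_hasPath_le_of_state (V := V) hp0 hp1 ht hz hxσ _ (fun _ => p) ∅ [] ∅ univ 0
    (Nat.lt_succ_self _) (fun _ => hp0) (fun _ => hp1) (fun _ _ => rfl) (by simp) (by simp)
    (by simp) (by simp) (by simp) (by simp) (by simp) (by simp) (by simp) (by simp)
  simpa using h

end LongPath

/-! ### Linear paths in supercritical random graphs -/

section LongPathAsymptotics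

open Filter

theorem exp_neg_le_one_sub_add_sq {t : ℝ} (ht : 0 ≤ t) : Real.exp (-t) ≤ 1 - t + t ^ 2 := by
  have h1 : 1 + t ≤ Real.exp t := by linarith [Real.add_one_le_exp t]
  rw [Real.exp_neg]
  refine (inv_anti₀ (by linarith) h1).trans ?_
  rw [inv_le_iff_one_le_mul₀ (by linarith)]
  nlinarith [pow_nonneg ht 3]

theorem lt_mul_of_between {ε n z ℓ : ℝ} (hε0 : 0 < ε) (hε1 : ε ≤ 1) (hn : 0 < n)
    (hz0 : ε / 8 * (1 + 5 * ε / 8) * n ≤ z) (hz1 : z ≤ n / 2) (hℓ : ℓ ≤ ε ^ 2 / 128 * n) :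
    ε / 8 * n ^ 2 < z * (n - z - ℓ) := by
  have hy0 : 0 < ε / 8 * (1 + 5 * ε / 8) := by positivity
  have hy1 : ε / 8 * (1 + 5 * ε / 8) ≤ 13 / 64 * ε := by nlinarith
  set y := ε / 8 * (1 + 5 * ε / 8) with hy
  have hz : 0 ≤ z := le_trans (by positivity) hz0
  have h1 : 0 ≤ (z - y * n) * (n / 2 - z) := mul_nonneg (by linarith) (by linarith)
  have h2 : z * ℓ ≤ z * (ε ^ 2 / 128 * n) := mul_le_mul_of_nonneg_left hℓ hz
  have hs : ε ^ 2 ≤ ε := by nlinarith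
  have h3 : 0 ≤ (z - y * n) * (n * (1 / 2 - y - ε ^ 2 / 128)) :=
    mul_nonneg (by linarith) (mul_nonneg hn.le (by linarith))
  have h4 : ε / 8 < y * (1 - y - ε ^ 2 / 128) := by
    have h5 : 1 < (1 + 5 * ε / 8) * (1 - y - ε ^ 2 / 128) := by nlinarith
    calc ε / 8 = ε / 8 * 1 := (mul_one _).symm
      _ < ε / 8 * ((1 + 5 * ε / 8) * (1 - y - ε ^ 2 / 128)) :=
          mul_lt_mul_of_pos_left h5 (by positivity)
      _ = y * (1 - y - ε ^ 2 / 128) := by rw [hy]; ring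
  have h6 : ε / 8 * n ^ 2 < y * (1 - y - ε ^ 2 / 128) * n ^ 2 :=
    mul_lt_mul_of_pos_right h4 (by positivity)
  nlinarith

/-- A supercritical random graph contains a path of linear length with high probability. -/
theorem tendsto_bernP_not_hasPath {ε : ℝ} (hε0 : 0 < ε) (hε1 : ε ≤ 1) :
    Tendsto (fun n : ℕ => bernP (fun _ : Sym2 (Fin n) => (1 + ε) / (n : ℝ))
      (fun ω => ¬ HasPath (boolGraph ω) ⌊ε ^ 2 / 128 * (n : ℝ)⌋₊)) atTop (nhds 0) := by
  have hlim : Tendsto (fun n : ℕ => Real.exp (1 - ε / 16 * (ε / 8 * (ε / 8)) * (n : ℝ))) atTop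
      (nhds 0) := by
    refine Real.tendsto_exp_atBot.comp ?_
    simp only [sub_eq_add_neg]
    refine tendsto_atBot_add_const_left _ _ (tendsto_neg_atTop_atBot.comp ?_)
    exact tendsto_natCast_atTop_atTop.const_mul_atTop (by positivity)
  have hev : ∀ᶠ n : ℕ in atTop, 2 ≤ n ∧ 128 / ε ^ 2 ≤ (n : ℝ) :=
    (eventually_ge_atTop 2).and (tendsto_natCast_atTop_atTop.eventually_ge_atTop _)
  have hp : ∀ n : ℕ, 2 ≤ n → 0 ≤ (1 + ε) / (n : ℝ) ∧ (1 + ε) / (n : ℝ) ≤ 1 := by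
    intro n hn
    have hn' : (2 : ℝ) ≤ n := by exact_mod_cast hn
    exact ⟨by positivity, (div_le_one (by linarith)).2 (by linarith)⟩
  refine squeeze_zero' (hev.mono fun n hn => bernP_nonneg (fun _ => (hp n hn.1).1)
    (fun _ => (hp n hn.1).2) _) (hev.mono fun n hn => ?_) hlim
  obtain ⟨hn2, hnε⟩ := hn
  obtain ⟨hp0, hp1⟩ := hp n hn2
  have hn' : (2 : ℝ) ≤ n := by exact_mod_cast hn2
  have hnpos : (0 : ℝ) < n := by linarith
  have hbig : 1 ≤ ε / 8 * (ε / 16) * n := by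
    rw [div_le_iff₀ (by positivity)] at hnε
    linarith
  set ℓ := ⌊ε ^ 2 / 128 * (n : ℝ)⌋₊ with hℓ
  set x := ⌊ε / 8 * (1 + 3 * ε / 4) * (n : ℝ)⌋₊ with hx
  set N := ⌊ε / 8 * (n : ℝ) ^ 2⌋₊ with hN
  have hℓ' : (ℓ : ℝ) ≤ ε ^ 2 / 128 * n := Nat.floor_le (by positivity)
  have hx' : (x : ℝ) ≤ ε / 8 * (1 + 3 * ε / 4) * n := Nat.floor_le (by positivity)
  have hx'' : ε / 8 * (1 + 3 * ε / 4) * n < x + 1 := Nat.lt_floor_add_one _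
  have hN' : (N : ℝ) ≤ ε / 8 * (n : ℝ) ^ 2 := Nat.floor_le (by positivity)
  have hN'' : ε / 8 * (n : ℝ) ^ 2 < N + 1 := Nat.lt_floor_add_one _
  have hσ : n / 2 - 1 + 1 = n / 2 := by omega
  have hhalf : ((n / 2 : ℕ) : ℝ) ≤ (n : ℝ) / 2 := Nat.cast_div_le
  have hz : ∀ z, x - ℓ ≤ z → z ≤ n / 2 - 1 + 1 → N < z * (Fintype.card (Fin n) - z - ℓ) := by
    intro z hz1 hz2
    rw [hσ] at hz2
    rw [Fintype.card_fin]
    have hz1' : (x : ℝ) ≤ z + ℓ := by exact_mod_cast (by omega : x ≤ z + ℓ)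
    have hz2' : (z : ℝ) ≤ (n : ℝ) / 2 :=
      le_trans (by exact_mod_cast hz2) hhalf
    have hsub : (n : ℝ) - z - ℓ ≤ ((n - z - ℓ : ℕ) : ℝ) := by
      have : n ≤ (n - z - ℓ) + z + ℓ := by omega
      have : (n : ℝ) ≤ ((n - z - ℓ : ℕ) : ℝ) + z + ℓ := by exact_mod_cast this
      linarith
    have key := lt_mul_of_between hε0 hε1 hnpos (z := z) (ℓ := ℓ) (by linarith) hz2' hℓ'
    have : (N : ℝ) < z * ((n - z - ℓ : ℕ) : ℝ) :=
      (hN'.trans_lt key).trans_le (mul_le_mul_of_nonneg_left hsub (Nat.cast_nonneg _))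
    exact_mod_cast this
  have hxσ : x ≤ ℓ + (n / 2 - 1) + 1 := by
    have hn4 : x ≤ n / 2 := by
      rw [Nat.le_div_iff_mul_le two_pos]
      have hc : ε / 8 * (1 + 3 * ε / 4) ≤ 1 / 2 := by nlinarith
      have := mul_le_mul_of_nonneg_right hc hnpos.le
      have : (x : ℝ) * 2 ≤ n := by linarith
      exact_mod_cast this
    omega
  -- Here `t = ε/16`. The loss `t²` lowers the factor `1 + ε` to at least `1 + 7ε/8`, still above
  -- the `1 + 3ε/4` in `x`; the gap `ε/8` gives the exponential decay.
  have ht : (0 : ℝ) ≤ ε / 16 := by positivity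
  refine (bernP_not_hasPath_le hp0 hp1 ht hz hxσ).trans ?_
  have hM : 1 - (1 + ε) / (n : ℝ) + (1 + ε) / n * Real.exp (-(ε / 16)) ≤
      Real.exp (-((1 + ε) / n * (ε / 16 - (ε / 16) ^ 2))) := by
    have h1 := mul_le_mul_of_nonneg_left (exp_neg_le_one_sub_add_sq ht) hp0
    have h2 := Real.add_one_le_exp (-((1 + ε) / n * (ε / 16 - (ε / 16) ^ 2)))
    linarith
  have hM0 : 0 ≤ 1 - (1 + ε) / (n : ℝ) + (1 + ε) / n * Real.exp (-(ε / 16)) := by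
    have := mul_nonneg hp0 (Real.exp_pos (-(ε / 16))).le
    linarith
  refine (mul_le_mul_of_nonneg_left (pow_le_pow_left₀ hM0 hM N) (Real.exp_pos _).le).trans ?_
  rw [← Real.exp_nat_mul, ← Real.exp_add, Real.exp_le_exp]
  have hNn : ε / 8 * n - 1 / n ≤ N / n := by
    rw [le_div_iff₀ hnpos]
    have : 1 / (n : ℝ) * n = 1 := by field_simp
    linarith
  have hn1 : 1 / (n : ℝ) ≤ 1 / 2 := one_div_le_one_div_of_le two_pos hn'
  have e1 : (N : ℝ) * -((1 + ε) / n * (ε / 16 - (ε / 16) ^ 2)) =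
      -((N / n) * (ε / 16 * ((1 + ε) * (1 - ε / 16)))) := by ring
  rw [e1]
  have h7 : 1 + 7 * ε / 8 ≤ (1 + ε) * (1 - ε / 16) := by nlinarith
  have h8 : (1 + ε) * (1 - ε / 16) ≤ 2 := by nlinarith
  set w := (1 + ε) * (1 - ε / 16) with hw
  have hw0 : 0 ≤ w := by linarith
  have h9 := mul_le_mul_of_nonneg_right hNn (by positivity : 0 ≤ ε / 16 * w)
  have h10 : 1 / (n : ℝ) * (ε / 16 * w) ≤ 1 / 2 * (ε / 16 * w) :=
    mul_le_mul_of_nonneg_right hn1 (by positivity)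
  have h11 : ε / 16 * w ≤ 1 / 16 * 2 := mul_le_mul (by linarith) h8 hw0 (by norm_num)
  have h12 : ε / 8 * n * (ε / 16) * (1 + 7 * ε / 8) ≤ ε / 8 * n * (ε / 16) * w :=
    mul_le_mul_of_nonneg_left h7 (by positivity)
  have h13 : ε / 16 * x ≤ ε / 16 * (ε / 8 * (1 + 3 * ε / 4) * n) :=
    mul_le_mul_of_nonneg_left hx' ht
  linarith

end LongPathAsymptotics

/-! ### Edges between disjoint vertex sets -/

section Hits

open Finset

variable {V : Type*}

/-- Some pair between `u` and `B` is marked `true`. -/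
def Hits (ω : Sym2 V → Bool) (u B : Finset V) : Prop := ∃ x ∈ u, ∃ y ∈ B, ω s(x, y) = true

open Classical in
/-- The indicator function of `Hits`. -/
noncomputable def hitInd (u B : Finset V) (ω : Sym2 V → Bool) : ℝ := if Hits ω u B then 1 else 0

theorem hitInd_eq_or (u B : Finset V) (ω : Sym2 V → Bool) :
    hitInd u B ω = 0 ∨ hitInd u B ω = 1 := by
  unfold hitInd
  split_ifs <;> simp

theorem hitInd_mul_self (u B : Finset V) (ω : Sym2 V → Bool) :
    hitInd u B ω * hitInd u B ω = hitInd u B ω := by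
  rcases hitInd_eq_or u B ω with h | h <;> simp [h]

variable [DecidableEq V]

/-- The pairs between `u` and `B`. -/
def pairsBetween (u B : Finset V) : Finset (Sym2 V) := (u ×ˢ B).image fun z => s(z.1, z.2)

theorem mem_pairsBetween {u B : Finset V} {e : Sym2 V} :
    e ∈ pairsBetween u B ↔ ∃ x ∈ u, ∃ y ∈ B, s(x, y) = e := by
  simp [pairsBetween, and_assoc]

theorem pairsBetween_mono {u u' B : Finset V} (h : u ⊆ u') :
    pairsBetween u B ⊆ pairsBetween u' B :=
  image_subset_image (product_subset_product_left h)

theorem hits_iff {ω : Sym2 V → Bool} {u B : Finset V} :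
    Hits ω u B ↔ ∃ e ∈ pairsBetween u B, ω e = true := by
  simp only [Hits, mem_pairsBetween]
  exact ⟨fun ⟨x, hx, y, hy, h⟩ => ⟨_, ⟨x, hx, y, hy, rfl⟩, h⟩,
    fun ⟨_, ⟨x, hx, y, hy, he⟩, h⟩ => ⟨x, hx, y, hy, he ▸ h⟩⟩

theorem card_pairsBetween {u B : Finset V} (h : Disjoint u B) :
    (pairsBetween u B).card = u.card * B.card := by
  rw [pairsBetween, card_image_of_injOn, card_product]
  rintro ⟨x, y⟩ hz ⟨x', y'⟩ hz' he
  simp only [coe_product, Set.mem_prod, mem_coe] at hz hz'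
  simp only [Sym2.eq_iff] at he
  rcases he with ⟨h1, h2⟩ | ⟨h1, -⟩
  · simp [h1, h2]
  · exact absurd (h1 ▸ hz.1) (disjoint_right.1 h hz'.2)

theorem disjoint_pairsBetween {u u' B B' : Finset V} (h : Disjoint u u' ∨ Disjoint B B')
    (h' : Disjoint u B') : Disjoint (pairsBetween u B) (pairsBetween u' B') := by
  rw [disjoint_left]
  intro e he he'
  obtain ⟨x, hx, y, hy, rfl⟩ := mem_pairsBetween.1 he
  obtain ⟨x', hx', y', hy', he⟩ := mem_pairsBetween.1 he'
  rcases Sym2.eq_iff.1 he with ⟨rfl, rfl⟩ | ⟨rfl, rfl⟩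
  · rcases h with h | h
    · exact disjoint_left.1 h hx hx'
    · exact disjoint_left.1 h hy hy'
  · exact disjoint_left.1 h' hx hy'

theorem dependsOn_hitInd (u B : Finset V) :
    DependsOn (hitInd u B) (pairsBetween u B : Set (Sym2 V)) := by
  intro ω ω' h
  have : Hits ω u B ↔ Hits ω' u B := by
    simp only [hits_iff]
    exact exists_congr fun e => and_congr_right fun he => by rw [h e he]
  by_cases h1 : Hits ω u B
  · simp [hitInd, h1, this.1 h1]
  · simp [hitInd, h1, mt this.2 h1]

theorem dependsOn_mul_hitInd {u B B' : Finset V} :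
    DependsOn (fun ω => hitInd u B ω * hitInd u B' ω)
      (pairsBetween u B ∪ pairsBetween u B' : Set (Sym2 V)) := by
  intro ω ω' h
  have h1 := dependsOn_hitInd u B (fun e he => h e (Or.inl he))
  have h2 := dependsOn_hitInd u B' (fun e he => h e (Or.inr he))
  simp only [h1, h2]

variable [Fintype V]

theorem bernE_hitInd {r : Sym2 V → ℝ} {p : ℝ} {u B : Finset V} (hd : Disjoint u B)
    (hr : ∀ e ∈ pairsBetween u B, r e = p) :
    bernE r (hitInd u B) = 1 - (1 - p) ^ (u.card * B.card) := by
  have h1 : ∀ ω, hitInd u B ω =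
      1 - ∏ e, (if e ∈ pairsBetween u B then (if ω e then (0 : ℝ) else 1) else 1) := by
    intro ω
    unfold hitInd
    split_ifs with h
    · obtain ⟨e, he, hω⟩ := hits_iff.1 h
      rw [prod_eq_zero (mem_univ e) (by simp [he, hω]), sub_zero]
    · rw [prod_eq_one, sub_self]
      intro e _
      split_ifs with he hω
      · exact absurd (hits_iff.2 ⟨e, he, hω⟩) h
      · rfl
      · rfl
  rw [funext h1, bernE_sub, bernE_const,
    bernE_prod r (fun e b => if e ∈ pairsBetween u B then (if b then (0 : ℝ) else 1) else 1)]
  congr 1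
  rw [← card_pairsBetween hd, ← prod_const, ← prod_subset (subset_univ (pairsBetween u B))]
  · refine prod_congr rfl fun e he => ?_
    simp [he, hr e he]
  · intro e _ he
    simp [he]

variable {ι : Type*} [DecidableEq ι]

/-- Hits on distinct blocks are independent, giving `q ^ 2`; for equal blocks the indicator is
idempotent, giving `q`. -/
theorem bernE_hitInd_mul_le {r : Sym2 V → ℝ} {p : ℝ} {u : Finset V} {B : ι → Finset V} {b : ℕ}
    (hd : ∀ i, Disjoint u (B i)) (hB : Pairwise fun i j => Disjoint (B i) (B j))
    (hb : ∀ i, (B i).card = b) (hr : ∀ i, ∀ e ∈ pairsBetween u (B i), r e = p)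
    {q : ℝ} (hq : q = 1 - (1 - p) ^ (u.card * b)) (i i' : ι) :
    bernE r (fun ω => hitInd u (B i) ω * hitInd u (B i') ω) ≤
      q ^ 2 + (if i = i' then q else 0) := by
  have hE : ∀ i, bernE r (hitInd u (B i)) = q := fun i => by
    rw [bernE_hitInd (hd i) (hr i), hb, hq]
  rcases eq_or_ne i i' with rfl | hne
  · simp only [hitInd_mul_self, if_true]
    rw [show bernE r (fun ω => hitInd u (B i) ω) = q from hE i]
    linarith [sq_nonneg q]
  · rw [bernE_mul_of_dependsOn r (f := hitInd u (B i)) (g := hitInd u (B i'))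
      (by exact_mod_cast disjoint_pairsBetween (Or.inr (hB hne)) (hd i'))
      (dependsOn_hitInd _ _) (dependsOn_hitInd _ _), hE, hE, if_neg hne]
    linarith [sq_nonneg q]

/-- A second moment bound for the event that two disjoint sets `u`, `u'` hit the two ends of some
pair in `F`. -/
theorem le_bernP_exists_hits {r : Sym2 V → ℝ} (hr0 : ∀ e, 0 ≤ r e) (hr1 : ∀ e, r e ≤ 1)
    {p : ℝ} {u u' : Finset V} {B : ι → Finset V} {b s : ℕ}
    (huu' : Disjoint u u') (hd : ∀ i, Disjoint u (B i)) (hd' : ∀ i, Disjoint u' (B i))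
    (hB : Pairwise fun i j => Disjoint (B i) (B j)) (hb : ∀ i, (B i).card = b)
    (hu : u.card = s) (hu' : u'.card = s)
    (hr : ∀ i, ∀ e ∈ pairsBetween u (B i), r e = p)
    (hr' : ∀ i, ∀ e ∈ pairsBetween u' (B i), r e = p)
    {q : ℝ} (hq0 : 0 ≤ q) (hq : q = 1 - (1 - p) ^ (s * b)) (F : Finset (ι × ι)) {D : ℝ}
    (hout : ∀ i, ((F.filter fun z => z.1 = i).card : ℝ) ≤ D)
    (hin : ∀ j, ((F.filter fun z => z.2 = j).card : ℝ) ≤ D) (t : ℝ) :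
    2 * t * (F.card * q ^ 2) -
      t ^ 2 * (F.card ^ 2 * q ^ 4 + 2 * (F.card * D * q ^ 3) + F.card * q ^ 2) ≤
      bernP r (fun ω => ∃ z ∈ F, Hits ω u (B z.1) ∧ Hits ω u' (B z.2)) := by
  have hE : ∀ z : ι × ι, bernE r (fun ω => hitInd u (B z.1) ω * hitInd u' (B z.2) ω) = q ^ 2 := by
    intro z
    rw [bernE_mul_of_dependsOn r (f := hitInd u (B z.1)) (g := hitInd u' (B z.2))
      (by exact_mod_cast disjoint_pairsBetween (Or.inl huu') (hd z.2))
      (dependsOn_hitInd _ _) (dependsOn_hitInd _ _), bernE_hitInd (hd _) (hr _),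
      bernE_hitInd (hd' _) (hr' _), hb, hb, hu, hu', ← hq]
    ring
  have hEE : ∀ z w : ι × ι, bernE r (fun ω => hitInd u (B z.1) ω * hitInd u' (B z.2) ω *
      (hitInd u (B w.1) ω * hitInd u' (B w.2) ω)) ≤
      (q ^ 2 + if z.1 = w.1 then q else 0) * (q ^ 2 + if z.2 = w.2 then q else 0) := by
    intro z w
    have h1 : (fun ω => hitInd u (B z.1) ω * hitInd u' (B z.2) ω *
        (hitInd u (B w.1) ω * hitInd u' (B w.2) ω)) =
        fun ω => (hitInd u (B z.1) ω * hitInd u (B w.1) ω) *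
          (hitInd u' (B z.2) ω * hitInd u' (B w.2) ω) := by
      funext ω
      ring
    have hdis : ∀ i j, Disjoint (pairsBetween u (B i) : Set (Sym2 V)) (pairsBetween u' (B j)) :=
      fun i j => by exact_mod_cast disjoint_pairsBetween (Or.inl huu') (hd j)
    rw [h1, bernE_mul_of_dependsOn r
      (f := fun ω => hitInd u (B z.1) ω * hitInd u (B w.1) ω)
      (g := fun ω => hitInd u' (B z.2) ω * hitInd u' (B w.2) ω) ?_
      dependsOn_mul_hitInd dependsOn_mul_hitInd]
    · refine mul_le_mul (bernE_hitInd_mul_le hd hB hb hr (by rw [hq, hu]) _ _)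
        (bernE_hitInd_mul_le hd' hB hb hr' (by rw [hq, hu']) _ _) ?_ ?_
      · rw [← bernE_const r 0]
        refine bernE_mono hr0 hr1 fun ω => ?_
        rcases hitInd_eq_or u' (B z.2) ω with h | h <;>
          rcases hitInd_eq_or u' (B w.2) ω with h' | h' <;> simp [h, h']
      · have := sq_nonneg q
        split_ifs <;> linarith
    · simp only [Set.disjoint_union_left, Set.disjoint_union_right]
      exact ⟨⟨hdis _ _, hdis _ _⟩, ⟨hdis _ _, hdis _ _⟩⟩
  set X : (Sym2 V → Bool) → ℝ := fun ω => ∑ z ∈ F, hitInd u (B z.1) ω * hitInd u' (B z.2) ω with hX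
  have hEX : bernE r X = F.card * q ^ 2 := by
    rw [hX, bernE_sum, sum_congr rfl fun z _ => hE z, sum_const, nsmul_eq_mul]
  have hEX2 : bernE r (fun ω => X ω * X ω) ≤
      F.card ^ 2 * q ^ 4 + 2 * (F.card * D * q ^ 3) + F.card * q ^ 2 := by
    have h1 : (fun ω => X ω * X ω) = fun ω => ∑ z ∈ F, ∑ w ∈ F,
        hitInd u (B z.1) ω * hitInd u' (B z.2) ω *
          (hitInd u (B w.1) ω * hitInd u' (B w.2) ω) := by
      funext ω
      rw [hX]
      exact sum_mul_sum _ _ _ _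
    rw [h1, bernE_sum]
    have h2 : ∀ z ∈ F, bernE r (fun ω => ∑ w ∈ F, hitInd u (B z.1) ω * hitInd u' (B z.2) ω *
        (hitInd u (B w.1) ω * hitInd u' (B w.2) ω)) ≤
        F.card * q ^ 4 + 2 * (D * q ^ 3) + q ^ 2 := by
      intro z hz
      rw [bernE_sum]
      refine (sum_le_sum fun w _ => hEE z w).trans ?_
      -- The correction terms come from pairs sharing the first end, the second end, or both; the
      -- degree bound `D` controls the first two kinds.
      have h3 : ∀ w ∈ F, (q ^ 2 + if z.1 = w.1 then q else 0) *
          (q ^ 2 + if z.2 = w.2 then q else 0) =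
          q ^ 4 + (if w.1 = z.1 then q ^ 3 else 0) + (if w.2 = z.2 then q ^ 3 else 0) +
            (if w = z then q ^ 2 else 0) := by
        intro w _
        by_cases ha : w.1 = z.1 <;> by_cases hb : w.2 = z.2
        · simp only [ha, hb, Prod.ext_iff, and_self, if_true]; ring
        · simp only [ha, Ne.symm hb, hb, Prod.ext_iff, and_false, if_true, if_false]; ring
        · simp only [Ne.symm ha, ha, hb, Prod.ext_iff, false_and, if_true, if_false]; ring
        · simp only [Ne.symm ha, ha, Ne.symm hb, hb, Prod.ext_iff, false_and, if_false]; ring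
      rw [sum_congr rfl h3, sum_add_distrib, sum_add_distrib, sum_add_distrib, sum_const,
        nsmul_eq_mul, ← sum_filter, ← sum_filter, sum_const, sum_const, nsmul_eq_mul, nsmul_eq_mul,
        sum_ite_eq' F z, if_pos hz]
      have hq3 : 0 ≤ q ^ 3 := pow_nonneg hq0 3
      have h4 := mul_le_mul_of_nonneg_right (hout z.1) hq3
      have h5 := mul_le_mul_of_nonneg_right (hin z.2) hq3
      linarith
    refine (sum_le_sum h2).trans (le_of_eq ?_)
    rw [sum_const, nsmul_eq_mul]
    ring
  -- The left side is `1 - (1 - t * X) ^ 2`, hence at most 1, and it vanishes when `X = 0`.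
  have hpt : ∀ ω, 2 * t * X ω - t ^ 2 * (X ω * X ω) ≤
      @ite _ (∃ z ∈ F, Hits ω u (B z.1) ∧ Hits ω u' (B z.2)) (Classical.propDecidable _) (1 : ℝ) 0 := by
    intro ω
    split_ifs with h
    · nlinarith [sq_nonneg (1 - t * X ω)]
    · have : X ω = 0 := by
        refine sum_eq_zero fun z hz => ?_
        by_cases h1 : Hits ω u (B z.1)
        · have h2 : ¬ Hits ω u' (B z.2) := fun h2 => h ⟨z, hz, h1, h2⟩
          simp [hitInd, h2]
        · simp [hitInd, h1]
      simp [this]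
  have hfin := bernE_mono hr0 hr1 hpt
  rw [bernE_sub, bernE_const_mul, bernE_const_mul, hEX] at hfin
  refine le_trans ?_ hfin
  have := mul_le_mul_of_nonneg_left hEX2 (sq_nonneg t)
  linarith

theorem one_sub_one_sub_pow_le {p : ℝ} (hp1 : p ≤ 1) (m : ℕ) : 1 - (1 - p) ^ m ≤ p * m := by
  have := one_add_mul_le_pow (a := -p) (by linarith) m
  rw [← sub_eq_add_neg] at this
  linarith

theorem le_one_sub_one_sub_pow {p : ℝ} (hp0 : 0 ≤ p) (hp1 : p ≤ 1) {m : ℕ} (h : p * m ≤ 1) :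
    p * m / 2 ≤ 1 - (1 - p) ^ m := by
  have hm : 0 ≤ p * m := mul_nonneg hp0 (Nat.cast_nonneg _)
  have h1 : (1 - p) ^ m ≤ Real.exp (-(p * m)) := by
    have h2 : 1 - p ≤ Real.exp (-p) := by linarith [Real.add_one_le_exp (-p)]
    refine (pow_le_pow_left₀ (by linarith) h2 m).trans (le_of_eq ?_)
    rw [← Real.exp_nat_mul]
    congr 1
    ring
  have h3 : Real.exp (-(p * m)) ≤ 1 - p * m / 2 := by
    rw [Real.exp_neg, inv_le_iff_one_le_mul₀ (Real.exp_pos _)]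
    have h4 := mul_le_mul_of_nonneg_left (Real.add_one_le_exp (p * m))
      (by linarith : 0 ≤ 1 - p * m / 2)
    nlinarith
  linarith

/-- With `s` chosen so that each of `u`, `u'` hits about `1 / √|F|` of the sets `B i`, the two ends
of some pair in `F` are hit with probability bounded below. -/
theorem one_div_le_bernP_exists_hits {r : Sym2 V → ℝ} (hr0 : ∀ e, 0 ≤ r e) (hr1 : ∀ e, r e ≤ 1)
    {p : ℝ} (hp0 : 0 ≤ p) (hp1 : p ≤ 1) {u u' : Finset V} {B : ι → Finset V} {b s : ℕ}
    (huu' : Disjoint u u') (hd : ∀ i, Disjoint u (B i)) (hd' : ∀ i, Disjoint u' (B i))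
    (hB : Pairwise fun i j => Disjoint (B i) (B j)) (hb : ∀ i, (B i).card = b)
    (hu : u.card = s) (hu' : u'.card = s)
    (hr : ∀ i, ∀ e ∈ pairsBetween u (B i), r e = p)
    (hr' : ∀ i, ∀ e ∈ pairsBetween u' (B i), r e = p)
    (F : Finset (ι × ι)) (hF : F.Nonempty)
    (hout : ∀ i, ((F.filter fun z => z.1 = i).card : ℝ) ≤ 4 * √F.card)
    (hin : ∀ j, ((F.filter fun z => z.2 = j).card : ℝ) ≤ 4 * √F.card)
    (hs1 : 1 / 2 ≤ p * (s * b) * √F.card) (hs2 : p * (s * b) * √F.card ≤ 1) :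
    1 / 160 ≤ bernP r (fun ω => ∃ z ∈ F, Hits ω u (B z.1) ∧ Hits ω u' (B z.2)) := by
  have hf1 : (1 : ℝ) ≤ F.card := by exact_mod_cast hF.card_pos
  have hg1 : 1 ≤ √(F.card : ℝ) := Real.one_le_sqrt.2 hf1
  have hgg : √(F.card : ℝ) ^ 2 = F.card := Real.sq_sqrt (Nat.cast_nonneg _)
  have hm0 : 0 ≤ p * (s * b) := by positivity
  have hm1 : p * (s * b) ≤ 1 := by nlinarith
  have hq1 := one_sub_one_sub_pow_le hp1 (s * b)
  have hq2 := le_one_sub_one_sub_pow hp0 hp1 (m := s * b) (by exact_mod_cast hm1)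
  push_cast at hq1 hq2
  -- With `y = q√|F|` in `[1/4, 1]` the first moment is `y ^ 2` and the second at most `10 * y ^ 2`;
  -- the optimal `t = 1/10` yields `y ^ 2 / 10 ≥ 1/160`.
  have key := le_bernP_exists_hits hr0 hr1 huu' hd hd' hB hb hu hu' hr hr'
    (by linarith) rfl F hout hin (1 / 10)
  refine le_trans ?_ key
  set q := 1 - (1 - p) ^ (s * b) with hq
  set g := √(F.card : ℝ) with hg
  have hy1 : 1 / 4 ≤ q * g := by nlinarith
  have hy2 : q * g ≤ 1 := by nlinarith
  set y := q * g with hy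
  have e1 : (F.card : ℝ) * q ^ 2 = y ^ 2 := by rw [← hgg, hy]; ring
  have e2 : (F.card : ℝ) ^ 2 * q ^ 4 = y ^ 4 := by rw [← hgg, hy]; ring
  have e3 : (F.card : ℝ) * (4 * g) * q ^ 3 = 4 * y ^ 3 := by rw [← hgg, hy]; ring
  rw [e1, e2, e3]
  have hy3 : y ^ 3 ≤ y ^ 2 := pow_le_pow_of_le_one (by linarith) hy2 (by norm_num)
  have hy4 : y ^ 4 ≤ y ^ 2 := pow_le_pow_of_le_one (by linarith) hy2 (by norm_num)
  have hy5 : 1 / 16 ≤ y ^ 2 := by nlinarith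
  linarith

end Hits

/-! ### Joining disjoint connected sets by sprinkling -/

section Sprinkling

open Finset

variable {V : Type*}

theorem induce_connected_of_isChain {G : SimpleGraph V} {l : List V} (hne : l ≠ [])
    (hl : l.IsChain G.Adj) : (G.induce {v | v ∈ l}).Connected := by
  have h := (SimpleGraph.Walk.ofSupport l hne hl).connected_induce_support
  rwa [SimpleGraph.Walk.support_ofSupport] at h

theorem induce_connected_mono {G G' : SimpleGraph V} (h : G ≤ G') {s : Set V}
    (hs : (G.induce s).Connected) : (G'.induce s).Connected :=
  hs.mono (SimpleGraph.comap_monotone _ h)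

variable {ι : Type*} [Fintype ι] [DecidableEq ι]

/-- After discarding at most `d` indices, the sets `B i` can be enlarged by vertices from `L` to
disjoint connected sets that are joined for all pairs in `F`. -/
def Joinable (G : SimpleGraph V) (B : ι → Set V) (L : Set V) (F : Finset (ι × ι)) (d : ℝ) :
    Prop :=
  ∃ (W : Finset ι) (B' : ι → Set V), (Wᶜ.card : ℝ) ≤ d ∧ (∀ i, B i ⊆ B' i) ∧
    (∀ i, B' i ⊆ B i ∪ L) ∧ (Pairwise fun i j => Disjoint (B' i) (B' j)) ∧
    (∀ i, (G.induce (B' i)).Connected) ∧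
    ∀ z ∈ F, z.1 ∈ W → z.2 ∈ W → ∃ x ∈ B' z.1, ∃ y ∈ B' z.2, G.Adj x y

theorem Joinable.mono {G : SimpleGraph V} {B : ι → Set V} {L L' : Set V} {F : Finset (ι × ι)}
    {d d' : ℝ} (h : Joinable G B L F d) (hL : L ⊆ L') (hd : d ≤ d') : Joinable G B L' F d' := by
  obtain ⟨W, B', h1, h2, h3, h4⟩ := h
  exact ⟨W, B', h1.trans hd, h2, fun i => (h3 i).trans (Set.union_subset_union_right _ hL), h4⟩

theorem Joinable.of_empty {G : SimpleGraph V} {B : ι → Set V} {L : Set V} {d : ℝ} (hd : 0 ≤ d)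
    (hB : Pairwise fun i j => Disjoint (B i) (B j)) (hc : ∀ i, (G.induce (B i)).Connected) :
    Joinable G B L ∅ d :=
  ⟨univ, B, by simpa using hd, fun _ => subset_rfl, fun _ => Set.subset_union_left, hB, hc,
    by simp⟩

theorem Joinable.of_discard {G : SimpleGraph V} {B : ι → Set V} {L : Set V} {F : Finset (ι × ι)}
    {d : ℝ} (v : ι) (h : Joinable G B L (F.filter fun z => z.1 ≠ v ∧ z.2 ≠ v) d) :
    Joinable G B L F (d + 1) := by
  obtain ⟨W, B', h1, h2, h3, h4, h5, h6⟩ := h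
  refine ⟨W.erase v, B', ?_, h2, h3, h4, h5, fun z hz hz1 hz2 => ?_⟩
  · rw [compl_erase]
    have : ((insert v Wᶜ).card : ℝ) ≤ Wᶜ.card + 1 := by exact_mod_cast card_insert_le _ _
    linarith
  · exact h6 z (mem_filter.2 ⟨hz, ne_of_mem_erase hz1, ne_of_mem_erase hz2⟩)
      (mem_of_mem_erase hz1) (mem_of_mem_erase hz2)

/-- The connected set `U` is absorbed into the set of `i`. Adjacency is asked only to the original
sets `B i`, `B j`, so it does not matter how these have been enlarged in joining the other pairs. -/
theorem Joinable.of_connect {G : SimpleGraph V} {B : ι → Set V} {L U : Set V}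
    {F : Finset (ι × ι)} {d : ℝ} {i j : ι} (hij : i ≠ j) (h : Joinable G B L (F.erase (i, j)) d)
    (hUL : Disjoint U L) (hUB : ∀ i, Disjoint U (B i)) (hU : (G.induce U).Connected)
    (hi : ∃ x ∈ U, ∃ y ∈ B i, G.Adj x y) (hj : ∃ x ∈ U, ∃ y ∈ B j, G.Adj x y) :
    Joinable G B (U ∪ L) F d := by
  obtain ⟨W, B', h1, h2, h3, h4, h5, h6⟩ := h
  have hUB' : ∀ i, Disjoint U (B' i) := fun i =>
    (Set.disjoint_union_right.2 ⟨hUB i, hUL⟩).mono_right (h3 i)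
  have hsub : ∀ k, B' k ⊆ Function.update B' i (B' i ∪ U) k := by
    intro k
    rcases eq_or_ne k i with rfl | hk
    · rw [Function.update_self]
      exact Set.subset_union_left
    · rw [Function.update_of_ne hk]
  refine ⟨W, Function.update B' i (B' i ∪ U), h1, fun k => (h2 k).trans (hsub k), fun k => ?_, ?_,
    fun k => ?_, fun z hz hz1 hz2 => ?_⟩
  · rcases eq_or_ne k i with rfl | hk
    · rw [Function.update_self]
      intro v hv
      rcases hv with hv | hv
      · rcases h3 _ hv with h | h
        · exact Or.inl h
        · exact Or.inr (Or.inr h)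
      · exact Or.inr (Or.inl hv)
    · rw [Function.update_of_ne hk]
      exact (h3 k).trans (Set.union_subset_union_right _ Set.subset_union_right)
  · intro k k' hkk'
    rcases eq_or_ne k i with rfl | hk
    · rw [Function.update_self, Function.update_of_ne hkk'.symm]
      exact Set.disjoint_union_left.2 ⟨h4 hkk', hUB' _⟩
    · rw [Function.update_of_ne hk]
      rcases eq_or_ne k' i with rfl | hk'
      · rw [Function.update_self]
        exact Set.disjoint_union_right.2 ⟨h4 hkk', (hUB' _).symm⟩
      · rw [Function.update_of_ne hk']
        exact h4 hkk'
  · rcases eq_or_ne k i with rfl | hk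
    · rw [Function.update_self]
      obtain ⟨x, hx, y, hy, hxy⟩ := hi
      exact SimpleGraph.connected_induce_union (h5 k).preconnected hU.preconnected
        (h2 k hy) hx hxy.symm
    · rw [Function.update_of_ne hk]
      exact h5 k
  · by_cases hzij : z = (i, j)
    · subst hzij
      obtain ⟨x, hx, y, hy, hxy⟩ := hj
      refine ⟨x, ?_, y, hsub j (h2 j hy), hxy⟩
      simp only [Function.update_self]
      exact Or.inr hx
    · obtain ⟨x, hx, y, hy, hxy⟩ := h6 z (mem_erase.2 ⟨hzij, hz⟩) hz1 hz2
      exact ⟨x, hsub _ hx, y, hsub _ hy, hxy⟩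

theorem Joinable.of_hits [DecidableEq V] {K : SimpleGraph V} {ω : Sym2 V → Bool}
    {B : ι → Finset V} {L : Set V}
    {F : Finset (ι × ι)} {d : ℝ} {i j : ι} (hij : i ≠ j) {l : List V} (hl : l.IsChain K.Adj)
    (h : Joinable (K ⊔ boolGraph ω) (fun i => (B i : Set V)) L (F.erase (i, j)) d)
    (hlL : ∀ v ∈ l, v ∉ L) (hlB : ∀ v ∈ l, ∀ i, v ∉ B i)
    (hi : Hits ω l.toFinset (B i)) (hj : Hits ω l.toFinset (B j)) :
    Joinable (K ⊔ boolGraph ω) (fun i => (B i : Set V)) ({v | v ∈ l} ∪ L) F d := by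
  have hadj : ∀ k, Hits ω l.toFinset (B k) →
      ∃ x ∈ {v | v ∈ l}, ∃ y ∈ (B k : Set V), (K ⊔ boolGraph ω).Adj x y := by
    rintro k ⟨x, hx, y, hy, hxy⟩
    rw [List.mem_toFinset] at hx
    exact ⟨x, hx, y, hy, Or.inr (boolGraph_adj.2 ⟨hxy, fun he => hlB x hx k (he ▸ hy)⟩)⟩
  have hne : l ≠ [] := by
    rintro rfl
    obtain ⟨x, hx, -⟩ := hi
    simp at hx
  exact h.of_connect hij (Set.disjoint_left.2 hlL)
    (fun k => Set.disjoint_left.2 fun v hv => hlB v hv k)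
    (induce_connected_mono le_sup_left (induce_connected_of_isChain hne hl)) (hadj i hi) (hadj j hj)

/-- The balance of one sprinkling round: `x` is the cost of the path vertices used, `v` the gain on
success, and `c` the success probability. -/
theorem exp_mul_failure_le_one {v x c : ℝ} (hv0 : 0 ≤ v) (hv1 : v ≤ 1)
    (hx : x ≤ v / 640) (hc : 1 / 160 ≤ c) (hc1 : c ≤ 1) :
    Real.exp x * (c * Real.exp (-v) + (1 - c)) ≤ 1 := by
  have h1 : Real.exp x ≤ 1 + v / 320 := by
    have h2 : Real.exp x * (1 - x) ≤ 1 := by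
      have := mul_le_mul_of_nonneg_left (Real.add_one_le_exp (-x)) (Real.exp_pos x).le
      rw [← Real.exp_add, add_neg_cancel, Real.exp_zero] at this
      linarith
    have hpos := Real.exp_pos x
    nlinarith
  have h3 : Real.exp (-v) ≤ 1 - v / 2 := by
    rw [Real.exp_neg, inv_le_iff_one_le_mul₀ (Real.exp_pos _)]
    have h5 := mul_le_mul_of_nonneg_left (Real.add_one_le_exp v) (by linarith : 0 ≤ 1 - v / 2)
    nlinarith
  have h6 : c * Real.exp (-v) + (1 - c) ≤ 1 - v / 320 := by nlinarith
  have h7 : 0 ≤ c * Real.exp (-v) + (1 - c) :=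
    add_nonneg (mul_nonneg (by linarith) (Real.exp_pos _).le) (by linarith)
  calc Real.exp x * (c * Real.exp (-v) + (1 - c)) ≤ (1 + v / 320) * (1 - v / 320) :=
        mul_le_mul h1 h6 h7 (by linarith)
    _ ≤ 1 := by nlinarith

theorem inv_sqrt_le_sqrt_sub {f : ℝ} (hf : 1 ≤ f) : 1 / √f ≤ 2 * √f - 2 * √(f - 1) := by
  have h1 : 1 ≤ √f := Real.one_le_sqrt.2 hf
  have h2 : √f ^ 2 = f := Real.sq_sqrt (by linarith)
  have h3 : √(f - 1) ^ 2 = f - 1 := Real.sq_sqrt (by linarith)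
  rw [div_le_iff₀ (by linarith)]
  nlinarith [sq_nonneg (√f - √(f - 1))]

variable [Fintype V] [DecidableEq V]

/-- If the vertices on the chain `l` have fresh random edges to the sets `B i`, then all pairs in
`F` can be joined, except with a probability that is exponentially small in the length of `l`. -/
theorem bernP_not_joinable_le {K : SimpleGraph V} {B : ι → Finset V} {b : ℕ} (hb0 : 0 < b)
    (hB : Pairwise fun i j => Disjoint (B i) (B j)) (hb : ∀ i, (B i).card = b)
    (hBc : ∀ i, (K.induce (B i : Set V)).Connected) {p : ℝ} (hp0 : 0 < p) (hp1 : p ≤ 1) (m : ℕ) :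
    ∀ (r : Sym2 V → ℝ) (F : Finset (ι × ι)) (l : List V), F.card + l.length < m →
    (∀ e, 0 ≤ r e) → (∀ e, r e ≤ 1) → (∀ i, ∀ e ∈ pairsBetween l.toFinset (B i), r e = p) →
    l.Nodup → l.IsChain K.Adj → (∀ v ∈ l, ∀ i, v ∉ B i) → (∀ z ∈ F, z.1 ≠ z.2) →
    p * b * √F.card ≤ 1 →
    bernP r (fun ω => ¬ Joinable (K ⊔ boolGraph ω) (fun i => (B i : Set V)) {v | v ∈ l} F
      (√F.card / 2)) ≤ Real.exp (2 * √F.card - l.length * (p * b) / 1280) := by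
  induction m with
  | zero => intro _ _ _ h; omega
  | succ m ih =>
    intro r F l hm hr0 hr1 hr hl hlc hlB hF hpF
    have hb1 : (1 : ℝ) ≤ b := by exact_mod_cast hb0
    have hpb : 0 < p * b := by positivity
    rcases F.eq_empty_or_nonempty with rfl | hFne
    · refine le_trans (le_of_eq ?_) (Real.exp_pos _).le
      refine Eq.trans (congrArg (bernE r) (funext fun ω => if_neg ?_)) (bernE_const r 0)
      rw [not_not]
      refine Joinable.of_empty (by simp) (fun i j hij => by exact_mod_cast hB hij)
        fun i => induce_connected_mono le_sup_left (hBc i)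
    have hf1 : (1 : ℝ) ≤ F.card := by exact_mod_cast hFne.card_pos
    have hg1 : 1 ≤ √(F.card : ℝ) := Real.one_le_sqrt.2 hf1
    have hgg : √(F.card : ℝ) ^ 2 = F.card := Real.sq_sqrt (Nat.cast_nonneg _)
    set g := √(F.card : ℝ) with hg
    -- Discarding an index of high degree costs one unit of the budget `g / 2`, which the drop of
    -- the square root by 2 pays for.
    by_cases hdeg : ∃ v, 4 * g < ((F.filter fun z => z.1 = v ∨ z.2 = v).card : ℝ)
    · obtain ⟨v, hv⟩ := hdeg
      set F' := F.filter fun z => z.1 ≠ v ∧ z.2 ≠ v with hF'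
      have hcard : F'.card + (F.filter fun z => z.1 = v ∨ z.2 = v).card = F.card := by
        rw [hF', add_comm, ← card_filter_add_card_filter_not (s := F)
          (fun z => z.1 = v ∨ z.2 = v)]
        simp only [not_or]
      have hcardR : (F'.card : ℝ) + ((F.filter fun z => z.1 = v ∨ z.2 = v).card : ℝ) = F.card := by
        exact_mod_cast hcard
      have hlt : F'.card < F.card := by
        have : (F'.card : ℝ) < F.card := by linarith
        exact_mod_cast this
      -- More than `4g` of the `g ^ 2` pairs disappear, and `g ^ 2 - 4 * g ≤ (g - 2) ^ 2`.
      have hle : √(F'.card : ℝ) ≤ g - 2 := by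
        have hF'0 : (0 : ℝ) ≤ F'.card := Nat.cast_nonneg _
        refine Real.sqrt_le_iff.2 ⟨?_, ?_⟩ <;> nlinarith
      have hle' : √(F'.card : ℝ) ≤ g := by linarith
      have h := ih r F' l (by omega) hr0 hr1 hr hl hlc hlB (fun z hz => hF z (mem_filter.1 hz).1)
        ((mul_le_mul_of_nonneg_left hle' hpb.le).trans hpF)
      refine (bernP_mono_ae hr0 hr1 fun ω _ hω hj => hω ?_).trans
        (h.trans (Real.exp_le_exp.2 (by linarith)))
      exact hj.of_discard v |>.mono subset_rfl (by linarith)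
    push Not at hdeg
    -- This makes `s` vertices hit a given block with probability of order `1 / g`; since the number
    -- is at least 1, rounding loses at most a factor 2.
    set s := ⌊1 / (p * b * g)⌋₊ with hs
    have hpbg : 0 < p * b * g := by positivity
    have hone : 1 ≤ 1 / (p * b * g) := (one_le_div hpbg).2 hpF
    have hs_le : (s : ℝ) ≤ 1 / (p * b * g) := Nat.floor_le (by positivity)
    have hs_gt : 1 / (p * b * g) < s + 1 := Nat.lt_floor_add_one _
    have hs1 : 1 ≤ s := Nat.le_floor (by simpa using hone)
    have hs1' : (1 : ℝ) ≤ s := by exact_mod_cast hs1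
    have hprod1 : p * (s * b) * g ≤ 1 := by
      rw [le_div_iff₀ hpbg] at hs_le
      linarith
    have hprod2 : 1 / 2 ≤ p * (s * b) * g := by
      have h2 : 1 / (p * b * g) ≤ 2 * s := by linarith
      rw [div_le_iff₀ hpbg] at h2
      linarith
    by_cases hlen : l.length < 2 * s
    -- For so short a chain the claimed bound is at least 1.
    · refine (bernP_le_one hr0 hr1 _).trans (Real.one_le_exp ?_)
      have h1 : (l.length : ℝ) ≤ 2 * s := by exact_mod_cast hlen.le
      have h2 : (l.length : ℝ) * (p * b) ≤ 2 * s * (p * b) := mul_le_mul_of_nonneg_right h1 hpb.le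
      have h3 : s * (p * b) ≤ 1 := by nlinarith
      linarith
    push Not at hlen
    set l₁ := l.take (2 * s) with hl₁
    set l₂ := l.drop (2 * s) with hl₂
    have hsplit : l₁ ++ l₂ = l := List.take_append_drop _ _
    set u := (l.take s).toFinset with hu
    set u' := ((l.drop s).take s).toFinset with hu'
    have hl₁' : l₁ = l.take s ++ (l.drop s).take s := by
      rw [hl₁, two_mul, List.take_add]
    have hl₂len : l₂.length = l.length - 2 * s := by simp [hl₂]
    have hnd : (l₁ ++ l₂).Nodup := hsplit ▸ hl
    rw [List.nodup_append'] at hnd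
    have hnd₁ : (l.take s ++ (l.drop s).take s).Nodup := hl₁' ▸ hnd.1
    rw [List.nodup_append'] at hnd₁
    have hmem₁ : ∀ v ∈ l₁, v ∈ l := fun v hv => List.mem_of_mem_take hv
    have hmem₂ : ∀ v ∈ l₂, v ∈ l := fun v hv => List.mem_of_mem_drop hv
    have hul : u ⊆ l₁.toFinset := by
      intro v hv
      rw [hu, List.mem_toFinset] at hv
      rw [List.mem_toFinset, hl₁']
      exact List.mem_append_left _ hv
    have hul' : u' ⊆ l₁.toFinset := by
      intro v hv
      rw [hu', List.mem_toFinset] at hv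
      rw [List.mem_toFinset, hl₁']
      exact List.mem_append_right _ hv
    have hl₁l : l₁.toFinset ⊆ l.toFinset := fun v hv => by
      rw [List.mem_toFinset] at hv ⊢
      exact hmem₁ v hv
    have hl₂l : l₂.toFinset ⊆ l.toFinset := fun v hv => by
      rw [List.mem_toFinset] at hv ⊢
      exact hmem₂ v hv
    have hlBd : ∀ i, Disjoint l.toFinset (B i) := fun i =>
      disjoint_left.2 fun v hv => hlB v (List.mem_toFinset.1 hv) i
    have huu' : Disjoint u u' := disjoint_left.2 fun v hv hv' =>
      hnd₁.2.2 (List.mem_toFinset.1 hv) (List.mem_toFinset.1 hv')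
    have hucard : u.card = s := by
      rw [hu, List.toFinset_card_of_nodup hnd₁.1, List.length_take]
      omega
    have hucard' : u'.card = s := by
      rw [hu', List.toFinset_card_of_nodup hnd₁.2.1, List.length_take, List.length_drop]
      omega
    set H : (Sym2 V → Bool) → Prop := fun ω => ∃ z ∈ F, Hits ω u (B z.1) ∧ Hits ω u' (B z.2)
      with hH
    have hc : 1 / 160 ≤ bernP r H :=
      one_div_le_bernP_exists_hits hr0 hr1 hp0.le hp1 huu'
        (fun i => (hlBd i).mono_left (hul.trans hl₁l))
        (fun i => (hlBd i).mono_left (hul'.trans hl₁l)) hB hb hucard hucard'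
        (fun i e he => hr i e (pairsBetween_mono (hul.trans hl₁l) he))
        (fun i e he => hr i e (pairsBetween_mono (hul'.trans hl₁l) he)) F hFne
        (fun i => le_trans (by
          exact_mod_cast card_le_card (monotone_filter_right F fun z _ hz => Or.inl hz)) (hdeg i))
        (fun i => le_trans (by
          exact_mod_cast card_le_card (monotone_filter_right F fun z _ hz => Or.inr hz)) (hdeg i))
        hprod2 hprod1
    -- Only the pairs between the first `2s` chain vertices and the blocks are exposed; those from
    -- `l₂` stay fresh for the induction hypothesis.
    set A : Finset (Sym2 V) := univ.biUnion fun i => pairsBetween l₁.toFinset (B i) with hA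
    set J : (Sym2 V → Bool) → Prop := fun ω => ¬ Joinable (K ⊔ boolGraph ω)
      (fun i => (B i : Set V)) {v | v ∈ l} F (g / 2) with hJ
    set R : (Sym2 V → Bool) → Sym2 V → ℝ := fun ω e => if e ∈ A then ((ω e).toNat : ℝ) else r e
      with hR
    have hR0 : ∀ ω e, 0 ≤ R ω e := by
      intro ω e
      simp only [hR]
      split_ifs
      · positivity
      · exact hr0 e
    have hR1 : ∀ ω e, R ω e ≤ 1 := by
      intro ω e
      simp only [hR]
      split_ifs
      · cases ω e <;> simp
      · exact hr1 e
    have hRp : ∀ ω i, ∀ e ∈ pairsBetween l₂.toFinset (B i), R ω e = p := by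
      intro ω i e he
      have heA : e ∉ A := by
        intro heA
        obtain ⟨j, -, hj⟩ := mem_biUnion.1 heA
        have hdis : Disjoint l₁.toFinset l₂.toFinset := disjoint_left.2 fun v hv hv' =>
          hnd.2.2 (List.mem_toFinset.1 hv) (List.mem_toFinset.1 hv')
        exact disjoint_left.1 (disjoint_pairsBetween (Or.inl hdis)
          ((hlBd i).mono_left hl₁l)) hj he
      simp only [hR, if_neg heA]
      exact hr i e (pairsBetween_mono hl₂l he)
    have hchain := List.isChain_append.1 (hsplit ▸ hlc : (l₁ ++ l₂).IsChain K.Adj)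
    have hlset : {v | v ∈ l} = {v | v ∈ l₁} ∪ {v | v ∈ l₂} := by
      rw [← hsplit]
      ext v
      simp
    have hlenR : (l₂.length : ℝ) = l.length - 2 * s := by
      rw [hl₂len, Nat.cast_sub hlen]
      push_cast
      ring
    set h₀ := Real.exp (2 * g - l.length * (p * b) / 1280) with hh₀
    set x := s * (p * b) / 640 with hx
    have hfail : ∀ ω, bernP (R ω) J ≤ h₀ * Real.exp x := by
      intro ω
      have h := ih (R ω) F l₂ (by omega) (hR0 ω) (hR1 ω) (hRp ω) hnd.2.1 hchain.2.1
        (fun v hv => hlB v (hmem₂ v hv)) hF hpF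
      refine (bernP_mono_ae (hR0 ω) (hR1 ω) fun ω' _ hω' hj => hω' ?_).trans (h.trans (le_of_eq ?_))
      swap
      · exact hj.mono (fun v hv => hmem₂ v hv) le_rfl
      · rw [hlenR, hh₀, ← Real.exp_add, hx]
        congr 1
        ring
    -- A successful round removes one pair, lowering `2√|F|` by at least `1 / g`; the used vertices
    -- cost the factor `exp x` in either case.
    have hsucc : ∀ ω, H ω → bernP (R ω) J ≤ h₀ * Real.exp x * Real.exp (-(1 / g)) := by
      rintro ω ⟨⟨i, j⟩, hz, hzi, hzj⟩
      have hcE := card_erase_of_mem hz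
      have hcE' : ((F.erase (i, j)).card : ℝ) = F.card - 1 := by
        rw [hcE, Nat.cast_sub hFne.card_pos]
        simp
      have hgle : √((F.erase (i, j)).card : ℝ) ≤ g :=
        Real.sqrt_le_sqrt (by linarith)
      have h := ih (R ω) (F.erase (i, j)) l₂ (by have := hFne.card_pos; omega) (hR0 ω) (hR1 ω)
        (hRp ω) hnd.2.1 hchain.2.1
        (fun v hv => hlB v (hmem₂ v hv)) (fun z hz => hF z (mem_of_mem_erase hz))
        ((mul_le_mul_of_nonneg_left hgle hpb.le).trans hpF)
      refine (bernP_mono_ae (hR0 ω) (hR1 ω) fun ω' hw hω' hj => hω' ?_).trans (h.trans ?_)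
      swap
      · have hagree : ∀ k, ∀ w, w ⊆ l₁.toFinset → Hits ω w (B k) →
            Hits ω' l₁.toFinset (B k) := by
          intro k w hw' hk
          obtain ⟨e, he, heω⟩ := hits_iff.1 hk
          have he' := pairsBetween_mono hw' he
          refine hits_iff.2 ⟨e, he', eq_true_of_bernWeight_ne_zero hw ?_⟩
          have heA : e ∈ A := mem_biUnion.2 ⟨k, mem_univ _, he'⟩
          simp only [hR]
          rw [if_pos heA, heω]
          simp
        rw [hlset]
        exact (hj.mono subset_rfl (by linarith)).of_hits (hF _ hz) hchain.1
          (fun v hv hv' => hnd.2.2 hv hv') (fun v hv => hlB v (hmem₁ v hv))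
          (hagree i u hul hzi) (hagree j u' hul' hzj)
      · rw [hlenR, hh₀, ← Real.exp_add, ← Real.exp_add, hx, Real.exp_le_exp, hcE']
        have := inv_sqrt_le_sqrt_sub hf1
        rw [← hg] at this
        linarith
    have hexp : bernP r J = bernE r (fun ω => bernP (R ω) J) := bernE_expose r A _
    have hmain : bernP r J ≤ h₀ * Real.exp x * (bernP r H * Real.exp (-(1 / g)) +
        (1 - bernP r H)) := by
      rw [hexp, ← bernP_not, bernP, bernP, mul_comm (bernE r _) (Real.exp _), ← bernE_const_mul,
        ← bernE_add, ← bernE_const_mul]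
      refine bernE_mono hr0 hr1 fun ω => ?_
      by_cases hω : H ω
      · simpa [hω] using hsucc ω hω
      · simpa [hω] using hfail ω
    refine hmain.trans ?_
    have hxle : x ≤ 1 / g / 640 := by
      rw [hx]
      refine div_le_div_of_nonneg_right ?_ (by norm_num)
      rw [le_div_iff₀ (by linarith)]
      linarith
    have hfin := exp_mul_failure_le_one (by positivity) ((div_le_one (by linarith)).2 hg1) hxle
      hc (bernP_le_one hr0 hr1 H)
    have h₀pos : 0 < h₀ := Real.exp_pos _
    nlinarith

end Sprinkling

/-! ### The binomial random graph -/

section BinomialRandom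

open Finset MeasureTheory

variable {V : Type*} [Fintype V] [DecidableEq V]

/-- Coordinates on the diagonal are sampled too, but `boolGraph` ignores them and each contributes a
factor 1. -/
theorem bernP_boolGraph_eq (p : ℝ) (G : SimpleGraph V) :
    bernP (fun _ => p) (fun ω => boolGraph ω = G) =
      p ^ G.edgeSet.ncard * (1 - p) ^ ((Nat.card V).choose 2 - G.edgeSet.ncard) := by
  classical
  have hind : ∀ ω : Sym2 V → Bool, (@ite _ (boolGraph ω = G) (Classical.propDecidable _) (1 : ℝ) 0) =
      ∏ e, (if e ∈ (Sym2.diagSet : Set (Sym2 V)) then (1 : ℝ) else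
        if ω e = decide (e ∈ G.edgeSet) then 1 else 0) := by
    intro ω
    have hiff : boolGraph ω = G ↔ ∀ e ∉ (Sym2.diagSet : Set (Sym2 V)),
        ω e = decide (e ∈ G.edgeSet) := by
      constructor
      · rintro rfl e he
        induction e with
        | h x y =>
          have hxy : x ≠ y := fun h => he (by simp [h])
          rw [Bool.eq_iff_iff]
          simp [boolGraph_adj, hxy]
      · intro h
        ext x y
        rw [boolGraph_adj]
        constructor
        · rintro ⟨h1, h2⟩
          have h3 := h s(x, y) (by simpa using h2)
          rw [h1] at h3
          simpa using h3.symm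
        · intro hxy
          have h3 := h s(x, y) (by simpa using hxy.ne)
          exact ⟨by rw [h3]; simpa using hxy, hxy.ne⟩
    split_ifs with h
    · rw [hiff] at h
      refine (prod_eq_one fun e _ => ?_).symm
      split_ifs with h1 h2
      · rfl
      · rfl
      · exact absurd (h e h1) h2
    · rw [hiff] at h
      push Not at h
      obtain ⟨e, he, hne⟩ := h
      exact (prod_eq_zero (mem_univ e) (by rw [if_neg he, if_neg hne])).symm
  rw [bernP, funext hind, bernE_prod (fun _ => p) (fun e b => if e ∈ (Sym2.diagSet : Set (Sym2 V))
    then (1 : ℝ) else if b = decide (e ∈ G.edgeSet) then 1 else 0)]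
  have hfac : ∀ e : Sym2 V, (p * (if e ∈ (Sym2.diagSet : Set (Sym2 V)) then (1 : ℝ) else
      if true = decide (e ∈ G.edgeSet) then 1 else 0) +
      (1 - p) * (if e ∈ (Sym2.diagSet : Set (Sym2 V)) then (1 : ℝ) else
      if false = decide (e ∈ G.edgeSet) then 1 else 0)) =
      (if e ∈ G.edgeSet then p else 1) *
        (if e ∈ (Sym2.diagSet : Set (Sym2 V))ᶜ \ G.edgeSet then 1 - p else 1) := by
    intro e
    have hdiag : e ∈ G.edgeSet → e ∉ (Sym2.diagSet : Set (Sym2 V)) := by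
      intro h
      exact G.edgeSet_subset_compl_diagSet h
    by_cases h1 : e ∈ (Sym2.diagSet : Set (Sym2 V)) <;> by_cases h2 : e ∈ G.edgeSet
    · exact absurd h1 (hdiag h2)
    · simp [h1, h2]
    · simp [h1, h2]
    · simp [h1, h2]
  rw [prod_congr rfl fun e _ => hfac e, prod_mul_distrib, ← prod_filter, ← prod_filter, prod_const,
    prod_const]
  congr 2
  · rw [Set.ncard_eq_toFinset_card']
    congr 1
    ext e
    simp
  · rw [Nat.card_eq_fintype_card, ← Sym2.card_diagSet_compl, Fintype.card_eq_nat_card,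
      Nat.card_coe_set_eq, ← Set.ncard_sdiff G.edgeSet_subset_compl_diagSet,
      Set.ncard_eq_toFinset_card']
    congr 1
    ext e
    simp

theorem binomialRandom_eq_ofReal_bernP (p : unitInterval) (A : Set (SimpleGraph V)) :
    SimpleGraph.binomialRandom V p A =
      ENNReal.ofReal (bernP (fun _ => (p : ℝ)) (fun ω => boolGraph ω ∈ A)) := by
  classical
  have hA : bernP (fun _ => (p : ℝ)) (fun ω : Sym2 V → Bool => boolGraph ω ∈ A) =
      ∑ G ∈ A.toFinset, bernP (fun _ => (p : ℝ)) (fun ω => boolGraph ω = G) := by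
    simp only [bernP]
    rw [← bernE_sum]
    refine congrArg _ (funext fun ω => ?_)
    rw [sum_ite_eq]
    simp
  rw [hA, ENNReal.ofReal_sum_of_nonneg fun G _ => bernP_nonneg (fun _ => p.2.1) (fun _ => p.2.2) _]
  have hsing : MeasurableSingletonClass (SimpleGraph V) := by
    refine ⟨fun G => ?_⟩
    have h := SimpleGraph.measurable_edgeSet (V := V) (measurableSet_singleton G.edgeSet)
    convert h using 1
    ext H
    simp
  have htoNN : ∀ q : unitInterval, (unitInterval.toNNReal q : ENNReal) = ENNReal.ofReal q := fun q => by
    rw [← unitInterval.coe_toNNReal, ENNReal.ofReal_coe_nnreal]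
  conv_lhs => rw [← Set.coe_toFinset A]
  rw [← sum_measure_singleton]
  refine sum_congr rfl fun G _ => ?_
  rw [SimpleGraph.binomialRandom_singleton, bernP_boolGraph_eq,
    ENNReal.ofReal_mul (pow_nonneg p.2.1 _), ENNReal.ofReal_pow p.2.1,
    ENNReal.ofReal_pow (sub_nonneg.2 p.2.2), htoNN, htoNN, unitInterval.coe_symm_eq]

end BinomialRandom

/-! ### The upper bound -/

section UpperBound

open Finset Filter

/-- Each ordered pair of distinct branch sets selects an oriented edge; disjointness lets that edge
determine the pair, and there are two orientations per edge. -/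
theorem SimpleGraph.IsMinor.mul_sub_one_le {V : Type*} [Fintype V] {G : SimpleGraph V} {k : ℕ}
    (h : SimpleGraph.IsMinor (completeGraph (Fin k)) G) : k * (k - 1) ≤ 2 * G.edgeSet.ncard := by
  classical
  obtain ⟨B, -, hdisj, hadj⟩ := h
  have hex : ∀ z : (univ : Finset (Fin k)).offDiag, ∃ d : G.Dart,
      d.fst ∈ B z.1.1 ∧ d.snd ∈ B z.1.2 := by
    rintro ⟨⟨i, j⟩, hz⟩
    obtain ⟨x, hx, y, hy, hxy⟩ := hadj i j (by simpa using hz)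
    exact ⟨⟨(x, y), hxy⟩, hx, hy⟩
  choose f hf using hex
  have hdet : ∀ {i j : Fin k} {x : V}, x ∈ B i → x ∈ B j → i = j := by
    intro i j x hi hj
    by_contra hne
    exact Set.disjoint_left.1 (hdisj i j hne) hi hj
  have hinj : Function.Injective f := by
    intro z w hzw
    have h1 := hdet (hf z).1 (hzw ▸ (hf w).1)
    have h2 := hdet (hf z).2 (hzw ▸ (hf w).2)
    exact Subtype.ext (Prod.ext h1 h2)
  have hcard := Fintype.card_le_of_injective f hinj
  rw [Fintype.card_coe, offDiag_card, card_univ, Fintype.card_fin,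
    G.dart_card_eq_twice_card_edges] at hcard
  rw [Nat.mul_sub_one, Set.ncard_eq_toFinset_card']
  exact hcard

/-- Markov's inequality for `2 ^ edges`: each of the at most `n ^ 2 / 2` non-diagonal pairs
contributes a factor `1 + p ≤ exp p`. -/
theorem bernP_le_card_edges {V : Type*} [Fintype V] [DecidableEq V] {p : ℝ} (hp0 : 0 ≤ p)
    (hp1 : p ≤ 1) (m : ℕ) :
    bernP (fun _ : Sym2 V => p) (fun ω => m ≤ (boolGraph ω).edgeSet.ncard) ≤
      Real.exp (p * (Fintype.card V) ^ 2 / 2) / 2 ^ m := by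
  classical
  have hpt : ∀ ω : Sym2 V → Bool,
      @ite _ (m ≤ (boolGraph ω).edgeSet.ncard) (Classical.propDecidable _) (1 : ℝ) 0 ≤
      (1 / 2 ^ m) * ∏ e, (if e ∈ (Sym2.diagSet : Set (Sym2 V)) then (1 : ℝ) else
        if ω e then 2 else 1) := by
    intro ω
    have hprod : ∏ e, (if e ∈ (Sym2.diagSet : Set (Sym2 V)) then (1 : ℝ) else
        if ω e then 2 else 1) = 2 ^ (boolGraph ω).edgeSet.ncard := by
      have hfac : ∀ e : Sym2 V, (if e ∈ (Sym2.diagSet : Set (Sym2 V)) then (1 : ℝ) else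
          if ω e then 2 else 1) = if e ∈ (boolGraph ω).edgeSet then 2 else 1 := by
        intro e
        have : e ∈ (boolGraph ω).edgeSet ↔ ω e = true ∧ e ∉ (Sym2.diagSet : Set (Sym2 V)) := by
          simp [boolGraph]
        by_cases h1 : e ∈ (Sym2.diagSet : Set (Sym2 V)) <;> by_cases h2 : ω e = true <;>
          simp only [this, h1, h2, if_true, if_false, and_true, and_false, not_true_eq_false,
            not_false_eq_true, Bool.false_eq_true]
      rw [prod_congr rfl fun e _ => hfac e, ← prod_filter, prod_const,
        Set.ncard_eq_toFinset_card']
      congr 2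
      ext e
      simp
    rw [hprod]
    split_ifs with h
    · rw [one_div, inv_mul_eq_div, one_le_div (by positivity)]
      exact pow_le_pow_right₀ one_le_two h
    · positivity
  refine (bernE_mono (fun _ => hp0) (fun _ => hp1) hpt).trans ?_
  rw [bernE_const_mul, bernE_prod (fun _ => p) (fun e b =>
    if e ∈ (Sym2.diagSet : Set (Sym2 V)) then (1 : ℝ) else if b then 2 else 1)]
  rw [one_div, inv_mul_eq_div]
  refine div_le_div_of_nonneg_right ?_ (by positivity)
  have hfac : ∀ e : Sym2 V, (p * (if e ∈ (Sym2.diagSet : Set (Sym2 V)) then (1 : ℝ) else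
      if true = true then 2 else 1) + (1 - p) * (if e ∈ (Sym2.diagSet : Set (Sym2 V)) then (1 : ℝ) else
      if false = true then 2 else 1)) = if e ∉ (Sym2.diagSet : Set (Sym2 V)) then 1 + p else 1 := by
    intro e
    by_cases h1 : e ∈ (Sym2.diagSet : Set (Sym2 V)) <;> simp [h1]
    ring
  rw [prod_congr rfl fun e _ => hfac e, ← prod_filter, prod_const]
  have hcard : (((univ.filter fun e => e ∉ (Sym2.diagSet : Set (Sym2 V))).card : ℕ) : ℝ) ≤
      (Fintype.card V : ℝ) ^ 2 / 2 := by
    have h1 : (univ.filter fun e => e ∉ (Sym2.diagSet : Set (Sym2 V))).card =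
        (Fintype.card V).choose 2 := by
      rw [← Sym2.card_diagSet_compl, Fintype.card_eq_nat_card, Nat.card_coe_set_eq,
        Set.ncard_eq_toFinset_card']
      congr 1
      ext e
      simp
    rw [h1, Nat.cast_choose_two]
    have : (0 : ℝ) ≤ Fintype.card V := Nat.cast_nonneg _
    nlinarith
  have h2 : 1 + p ≤ Real.exp p := by linarith [Real.add_one_le_exp p]
  refine (pow_le_pow_left₀ (by linarith) h2 _).trans ?_
  rw [← Real.exp_nat_mul, Real.exp_le_exp]
  nlinarith

theorem tendsto_bernP_lt_ccl {c : ℝ} (hc : 1 < c) :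
    Tendsto (fun n : ℕ => bernP (fun _ : Sym2 (Fin n) => c / (n : ℝ))
      (fun ω => 2 * √(c * (n : ℝ)) < ((boolGraph ω).ccl : ℝ))) atTop (nhds 0) := by
  have hlim : Tendsto (fun n : ℕ => Real.exp (1 - c / 2 * (n : ℝ))) atTop (nhds 0) := by
    refine Real.tendsto_exp_atBot.comp ?_
    simp only [sub_eq_add_neg]
    refine tendsto_atBot_add_const_left _ _ (tendsto_neg_atTop_atBot.comp ?_)
    exact tendsto_natCast_atTop_atTop.const_mul_atTop (by positivity)
  have hev : ∀ᶠ n : ℕ in atTop, c ≤ (n : ℝ) ∧ (4 : ℝ) ≤ n :=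
    (tendsto_natCast_atTop_atTop.eventually_ge_atTop _).and
      (tendsto_natCast_atTop_atTop.eventually_ge_atTop _)
  have hp : ∀ n : ℕ, c ≤ (n : ℝ) → 0 ≤ c / (n : ℝ) ∧ c / (n : ℝ) ≤ 1 := by
    intro n hn
    exact ⟨by positivity, (div_le_one (by linarith)).2 hn⟩
  refine squeeze_zero' (hev.mono fun n hn => bernP_nonneg (fun _ => (hp n hn.1).1)
    (fun _ => (hp n hn.1).2) _) (hev.mono fun n hn => ?_) hlim
  obtain ⟨hn1, hn4⟩ := hn
  obtain ⟨hp0, hp1⟩ := hp n hn1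
  have hnpos : (0 : ℝ) < n := by linarith
  -- With `w = √(cn) ≥ 2`, a clique minor of order `k > 2w` forces `k(k-1) ≥ 4w² - 2w ≥ 3w²`, hence
  -- at least `3cn/2` edges.
  set m := ⌊3 / 2 * (c * (n : ℝ))⌋₊ with hm
  have hm' : 3 / 2 * (c * (n : ℝ)) < m + 1 := Nat.lt_floor_add_one _
  have hstep : bernP (fun _ : Sym2 (Fin n) => c / (n : ℝ))
      (fun ω => 2 * √(c * (n : ℝ)) < ((boolGraph ω).ccl : ℝ)) ≤
      bernP (fun _ : Sym2 (Fin n) => c / (n : ℝ)) (fun ω => m ≤ (boolGraph ω).edgeSet.ncard) := by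
    refine bernP_mono_ae (fun _ => hp0) (fun _ => hp1) fun ω _ hω => ?_
    set k := (boolGraph ω).ccl with hk
    have hmin := (SimpleGraph.isGreatest_ccl (boolGraph ω)).1
    have hle := SimpleGraph.IsMinor.mul_sub_one_le hmin
    rw [← hk] at hle
    have hcn : 0 ≤ c * (n : ℝ) := by positivity
    have hsq : √(c * (n : ℝ)) ^ 2 = c * n := Real.sq_sqrt hcn
    have hs2 : 2 ≤ √(c * (n : ℝ)) := by
      refine Real.le_sqrt_of_sq_le ?_
      nlinarith
    have hk1 : 1 ≤ k := by
      have : (0 : ℝ) < k := by linarith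
      exact_mod_cast this
    have hle' : (k : ℝ) * (k - 1) ≤ 2 * ((boolGraph ω).edgeSet.ncard : ℝ) := by
      have : ((k * (k - 1) : ℕ) : ℝ) ≤ ((2 * (boolGraph ω).edgeSet.ncard : ℕ) : ℝ) := by
        exact_mod_cast hle
      push_cast [Nat.cast_sub hk1] at this
      exact this
    set w := √(c * (n : ℝ)) with hw
    have hfin : 3 / 2 * (c * n) ≤ ((boolGraph ω).edgeSet.ncard : ℝ) := by
      rw [← hsq]
      nlinarith
    have : (m : ℝ) ≤ ((boolGraph ω).edgeSet.ncard : ℝ) :=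
      (Nat.floor_le (by positivity)).trans hfin
    exact_mod_cast this
  refine (hstep.trans (bernP_le_card_edges hp0 hp1 m)).trans ?_
  have h2 : (2 : ℝ) ^ m = Real.exp (m * Real.log 2) := by
    rw [Real.exp_nat_mul, Real.exp_log two_pos]
  rw [h2, ← Real.exp_sub, Real.exp_le_exp, Fintype.card_fin]
  have h3 : c / (n : ℝ) * (n : ℝ) ^ 2 = c * n := by field_simp
  rw [h3]
  have h4 := Real.log_two_gt_d9
  have h5 := Real.log_two_lt_d9
  -- Since `log 2 > 2/3`, the denominator `2 ^ m` is at least `exp (c * n - 2 / 3)`, which beats the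
  -- numerator `exp (c * n / 2)`.
  have h6 : 2 / 3 * (3 / 2 * (c * (n : ℝ)) - 1) ≤ m * Real.log 2 := by
    have h7 : 2 / 3 * (3 / 2 * (c * (n : ℝ)) - 1) ≤ 2 / 3 * m := by linarith
    have h8 : 2 / 3 * (m : ℝ) ≤ Real.log 2 * m :=
      mul_le_mul_of_nonneg_right (by linarith) (Nat.cast_nonneg _)
    linarith
  linarith

end UpperBound

/-! ### The lower bound -/

section LowerBound

open Finset Filter

theorem boolGraph_or {V : Type*} (ω₁ ω₂ : Sym2 V → Bool) :
    boolGraph (fun e => ω₁ e || ω₂ e) = boolGraph ω₁ ⊔ boolGraph ω₂ := by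
  ext x y
  simp only [boolGraph_adj, SimpleGraph.sup_adj, Bool.or_eq_true]
  tauto

theorem Joinable.card_le_ccl {V : Type*} [Finite V] {G : SimpleGraph V} {k : ℕ}
    {B : Fin k → Set V} {L : Set V} {d : ℝ}
    (h : Joinable G B L (univ.filter fun z : Fin k × Fin k => z.1 < z.2) d) :
    (k : ℝ) - d ≤ G.ccl := by
  obtain ⟨W, B', h1, -, -, h4, h5, h6⟩ := h
  have hadj : ∀ i ∈ W, ∀ j ∈ W, i < j → ∃ x ∈ B' i, ∃ y ∈ B' j, G.Adj x y :=
    fun i hi j hj hij => h6 (i, j) (by simpa using hij) hi hj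
  have hminor : SimpleGraph.IsMinor (SimpleGraph.completeGraph (Fin W.card)) G := by
    have hinj : ∀ {a b}, a ≠ b → W.orderEmbOfFin rfl a ≠ W.orderEmbOfFin rfl b :=
      fun hab h => hab ((W.orderEmbOfFin rfl).injective h)
    refine ⟨fun i => B' (W.orderEmbOfFin rfl i), fun i => h5 _, fun i j hij => h4 (hinj hij),
      fun i j hij => ?_⟩
    have hi := W.orderEmbOfFin_mem rfl i
    have hj := W.orderEmbOfFin_mem rfl j
    rcases lt_or_gt_of_ne (hinj hij.ne) with hlt | hlt
    · exact hadj _ hi _ hj hlt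
    · obtain ⟨x, hx, y, hy, hxy⟩ := hadj _ hj _ hi hlt
      exact ⟨y, hy, x, hx, hxy.symm⟩
  have hle : W.card ≤ G.ccl := (SimpleGraph.isGreatest_ccl G).2 hminor
  have hcard : (W.card : ℝ) + Wᶜ.card = k := by
    have := W.card_add_card_compl
    rw [Fintype.card_fin] at this
    exact_mod_cast this
  have : (W.card : ℝ) ≤ G.ccl := by exact_mod_cast hle
  linarith

theorem sqrt_card_filter_lt_le (k : ℕ) :
    √((univ.filter fun z : Fin k × Fin k => z.1 < z.2).card : ℝ) ≤ k := by
  refine Real.sqrt_le_iff.2 ⟨Nat.cast_nonneg _, ?_⟩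
  have : (univ.filter fun z : Fin k × Fin k => z.1 < z.2).card ≤ k ^ 2 := by
    refine (card_le_univ _).trans (le_of_eq ?_)
    simp [sq]
  exact_mod_cast this

/-- Cutting the first `k * b` vertices of a path in `K` into `k` pieces and sprinkling random edges
yields a large complete minor. -/
theorem bernP_ccl_lt_le {V : Type*} [Fintype V] [DecidableEq V] {K : SimpleGraph V} {ℓ k b : ℕ}
    (hK : HasPath K ℓ) (hb0 : 0 < b) (hkb : k * b ≤ ℓ) {p : ℝ} (hp0 : 0 < p) (hp1 : p ≤ 1)
    (hpbk : p * b * k ≤ 1) :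
    bernP (fun _ : Sym2 V => p) (fun ω => ((K ⊔ boolGraph ω).ccl : ℝ) < k / 2) ≤
      Real.exp (2 * k - (ℓ - k * b) * (p * b) / 1280) := by
  obtain ⟨U, hU, hUc, hUℓ⟩ := hK
  set B : Fin k → Finset V := fun i => ((U.drop (i * b)).take b).toFinset with hBdef
  have htake : ∀ i : Fin k, ∀ v ∈ B i, v ∈ U.take ((i + 1) * b) := by
    intro i v hv
    rw [hBdef, List.mem_toFinset, List.take_drop] at hv
    rw [add_mul, one_mul]
    exact List.mem_of_mem_drop hv
  have hdrop : ∀ i : Fin k, ∀ v ∈ B i, v ∈ U.drop (i * b) := by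
    intro i v hv
    rw [hBdef, List.mem_toFinset] at hv
    exact List.mem_of_mem_take hv
  have hlt : ∀ i j : Fin k, i < j → Disjoint (B i) (B j) := by
    intro i j hij
    refine disjoint_left.2 fun v hv hv' => ?_
    exact List.disjoint_take_drop hU (Nat.mul_le_mul_right b (Nat.succ_le_of_lt hij))
      (htake i v hv) (hdrop j v hv')
  have hB : Pairwise fun i j => Disjoint (B i) (B j) := by
    intro i j hij
    rcases lt_or_gt_of_ne hij with h | h
    · exact hlt i j h
    · exact (hlt j i h).symm
  have hlen : ∀ i : Fin k, ((U.drop (i * b)).take b).length = b := by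
    intro i
    have h1 : (i + 1) * b ≤ k * b := Nat.mul_le_mul_right b (Nat.succ_le_of_lt i.2)
    rw [add_mul, one_mul] at h1
    rw [List.length_take, List.length_drop]
    omega
  have hb : ∀ i, (B i).card = b := by
    intro i
    rw [hBdef, List.toFinset_card_of_nodup, hlen]
    exact hU.sublist ((List.take_sublist _ _).trans (List.drop_sublist _ _))
  have hBc : ∀ i, (K.induce (B i : Set V)).Connected := by
    intro i
    rw [hBdef, List.coe_toFinset]
    refine induce_connected_of_isChain ?_ ((hUc.drop _).take _)
    rw [← List.length_pos_iff_ne_nil, hlen]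
    exact hb0
  set F := univ.filter fun z : Fin k × Fin k => z.1 < z.2 with hF
  have hFk : √(F.card : ℝ) ≤ k := sqrt_card_filter_lt_le k
  have hpb : 0 < p * b := by positivity
  have key := bernP_not_joinable_le hb0 hB hb hBc hp0 hp1 _ (fun _ => p) F (U.drop (k * b))
    (Nat.lt_succ_self _) (fun _ => hp0.le) (fun _ => hp1) (fun _ _ _ => rfl)
    (hU.sublist (List.drop_sublist _ _)) (hUc.drop _)
    (fun v hv i hvi => List.disjoint_take_drop hU
      (Nat.mul_le_mul_right b (Nat.succ_le_of_lt i.2)) (htake i v hvi) hv)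
    (fun z hz => (mem_filter.1 hz).2.ne) ((mul_le_mul_of_nonneg_left hFk hpb.le).trans hpbk)
  refine (bernP_mono_ae (fun _ => hp0.le) (fun _ => hp1) fun ω _ hω hj => ?_).trans
    (key.trans (Real.exp_le_exp.2 ?_))
  -- At most `√|F| / 2 ≤ k / 2` blocks have been discarded.
  · have := hj.card_le_ccl
    linarith
  · have h1 : (ℓ : ℝ) - k * b ≤ ((U.drop (k * b)).length : ℝ) := by
      rw [List.length_drop, Nat.cast_sub (hkb.trans hUℓ)]
      have : (ℓ : ℝ) ≤ U.length := by exact_mod_cast hUℓ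
      push_cast
      linarith
    have h2 := mul_le_mul_of_nonneg_right h1 hpb.le
    linarith

theorem tendsto_bernP_ccl_lt {c : ℝ} (hc : 1 < c) : ∃ δ : ℝ, 0 < δ ∧
    Tendsto (fun n : ℕ => bernP (fun _ : Sym2 (Fin n) => c / (n : ℝ))
      (fun ω => ((boolGraph ω).ccl : ℝ) < δ * √(n : ℝ))) atTop (nhds 0) := by
  set ε := min 1 ((c - 1) / 2) with hε
  have hε0 : 0 < ε := lt_min one_pos (by linarith)
  have hε1 : ε ≤ 1 := min_le_left _ _
  have hεc : 1 + ε < c := by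
    have : ε ≤ (c - 1) / 2 := min_le_right _ _
    linarith
  set γ := c - (1 + ε) with hγ
  have hγ0 : 0 < γ := by linarith
  set α := ε ^ 2 / 128 with hα
  have hα0 : 0 < α := by positivity
  -- The three bounds ensure, in order: `p₂ * b * k ≤ 1`; the blocks use at most a quarter of `α *
  -- n` vertices; and `2 * k` is at most half of the gain in the exponent from the remaining path.
  set η := min (min (1 / (2 * c)) (α / 8)) (α * γ / 10240) with hη
  have hη0 : 0 < η := lt_min (lt_min (by positivity) (by positivity)) (by positivity)
  have hη1 : 2 * c * η ≤ 1 := by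
    have : η ≤ 1 / (2 * c) := (min_le_left _ _).trans (min_le_left _ _)
    rw [le_div_iff₀ (by linarith)] at this
    linarith
  have hη2 : η ≤ α / 8 := (min_le_left _ _).trans (min_le_right _ _)
  have hη3 : η ≤ α * γ / 10240 := min_le_right _ _
  -- One factor 2 is for rounding `k`, the other for the discarded blocks.
  refine ⟨η / 4, by positivity, ?_⟩
  have hsqrt : Tendsto (fun n : ℕ => √(n : ℝ)) atTop atTop :=
    Real.tendsto_sqrt_atTop.comp tendsto_natCast_atTop_atTop
  have hlim : Tendsto (fun n : ℕ => bernP (fun _ : Sym2 (Fin n) => (1 + ε) / (n : ℝ))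
      (fun ω => ¬ HasPath (boolGraph ω) ⌊α * (n : ℝ)⌋₊) +
      Real.exp (-(α * γ / 5120 * √(n : ℝ)))) atTop (nhds 0) := by
    rw [← add_zero (0 : ℝ)]
    refine (tendsto_bernP_not_hasPath hε0 hε1).add ?_
    refine Real.tendsto_exp_atBot.comp (tendsto_neg_atTop_atBot.comp ?_)
    exact hsqrt.const_mul_atTop (by positivity)
  have hev : ∀ᶠ n : ℕ in atTop, c ≤ (n : ℝ) ∧ 4 / α ≤ (n : ℝ) ∧ 2 / η ≤ √(n : ℝ) :=
    (tendsto_natCast_atTop_atTop.eventually_ge_atTop _).and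
      ((tendsto_natCast_atTop_atTop.eventually_ge_atTop _).and
        (hsqrt.eventually_ge_atTop _))
  have hp : ∀ n : ℕ, c ≤ (n : ℝ) → 0 ≤ c / (n : ℝ) ∧ c / (n : ℝ) ≤ 1 := by
    intro n hn
    exact ⟨by positivity, (div_le_one (by linarith)).2 hn⟩
  refine squeeze_zero' (hev.mono fun n hn => bernP_nonneg (fun _ => (hp n hn.1).1)
    (fun _ => (hp n hn.1).2) _) (hev.mono fun n hn => ?_) hlim
  obtain ⟨hnc, hnα, hnη⟩ := hn
  obtain ⟨hp0, hp1⟩ := hp n hnc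
  have hnpos : (0 : ℝ) < n := by linarith
  set w := √(n : ℝ) with hw
  have hww : w * w = n := Real.mul_self_sqrt hnpos.le
  have hw1 : 1 ≤ w := Real.one_le_sqrt.2 (by linarith)
  have hw0 : 0 < w := by linarith
  rw [div_le_iff₀ hα0] at hnα
  rw [div_le_iff₀ hη0] at hnη
  set p := c / (n : ℝ) with hpdef
  set p₁ := (1 + ε) / (n : ℝ) with hp₁
  have hp₁0 : 0 ≤ p₁ := by positivity
  have hp₁p : p₁ + γ / n = p := by
    rw [hp₁, hpdef, hγ]
    ring
  have hγn : 0 < γ / n := by positivity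
  have hp₁1 : p₁ < 1 := by linarith
  -- The density for which the union of the two rounds has density exactly `p`; dividing by `1 - p₁`
  -- only increases it above `γ / n`.
  set p₂ := (p - p₁) / (1 - p₁) with hp₂
  have h1p₁ : 0 < 1 - p₁ := by linarith
  have hp₂eq : p₁ + (1 - p₁) * p₂ = p := by
    rw [hp₂]
    field_simp
    ring
  have hp₂lo : γ / n ≤ p₂ := by
    rw [hp₂, le_div_iff₀ h1p₁]
    nlinarith
  have hp₂hi : p₂ ≤ p := by
    rw [hp₂, div_le_iff₀ h1p₁]
    nlinarith
  have hp₂0 : 0 < p₂ := by linarith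
  have hp₂1 : p₂ ≤ 1 := by linarith
  set b := ⌈w⌉₊ with hb
  set k := ⌊η * w⌋₊ with hk
  set ℓ := ⌊α * (n : ℝ)⌋₊ with hℓ
  have hb1 : w ≤ b := Nat.le_ceil _
  have hb2 : (b : ℝ) ≤ 2 * w := by
    have := Nat.ceil_lt_add_one hw0.le
    linarith
  have hb0 : 0 < b := Nat.ceil_pos.2 hw0
  have hk1 : (k : ℝ) ≤ η * w := Nat.floor_le (by positivity)
  have hk2 : η * w < k + 1 := Nat.lt_floor_add_one _
  have hℓ2 : α * (n : ℝ) < ℓ + 1 := Nat.lt_floor_add_one _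
  have hkb : (k : ℝ) * b ≤ 2 * η * n := by
    calc (k : ℝ) * b ≤ (η * w) * (2 * w) := by gcongr
      _ = 2 * η * n := by rw [← hww]; ring
  have hηn : η * n ≤ α / 8 * n := mul_le_mul_of_nonneg_right hη2 hnpos.le
  have hkbℓ : α * n / 2 ≤ ℓ - (k : ℝ) * b := by linarith
  have hkbℓ' : k * b ≤ ℓ := by
    have h0 : 0 ≤ α * n / 2 := by positivity
    have : (k : ℝ) * b ≤ ℓ := by linarith
    exact_mod_cast this
  have hpbk : p₂ * b * k ≤ 1 := by
    calc p₂ * b * k ≤ p * (2 * w) * (η * w) := by gcongr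
      _ = 2 * η * (p * (w * w)) := by ring
      _ = 2 * c * η := by
        rw [hww, hpdef]
        field_simp
      _ ≤ 1 := hη1
  have hp₂b : γ / w ≤ p₂ * b := by
    calc γ / w = γ / n * w := by
          rw [← hww]
          field_simp
      _ ≤ p₂ * b := by gcongr
  have hexp : 2 * (k : ℝ) - (ℓ - k * b) * (p₂ * b) / 1280 ≤ -(α * γ / 5120 * w) := by
    have h1 : α * n / 2 * (γ / w) ≤ (ℓ - k * b) * (p₂ * b) :=
      mul_le_mul hkbℓ hp₂b (by positivity) (le_trans (by positivity) hkbℓ)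
    have h2 : α * n / 2 * (γ / w) = α * γ / 2 * w := by
      rw [← hww]
      field_simp
    have h3 : η * w ≤ α * γ / 10240 * w := mul_le_mul_of_nonneg_right hη3 hw0.le
    linarith
  set Bad : SimpleGraph (Fin n) → Prop := fun G => (G.ccl : ℝ) < η / 4 * w with hBad
  have hp₁le : ∀ _ : Sym2 (Fin n), p₁ ≤ 1 := fun _ => hp₁1.le
  have hinner : ∀ ω₁ : Sym2 (Fin n) → Bool,
      bernP (fun _ => p₂) (fun ω₂ => Bad (boolGraph fun e => ω₁ e || ω₂ e)) ≤
      @ite _ (¬ HasPath (boolGraph ω₁) ℓ) (Classical.propDecidable _) (1 : ℝ) 0 +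
        Real.exp (-(α * γ / 5120 * w)) := by
    intro ω₁
    by_cases hpath : HasPath (boolGraph ω₁) ℓ
    swap
    · rw [if_pos hpath]
      refine (bernP_le_one (fun _ => hp₂0.le) (fun _ => hp₂1) _).trans ?_
      linarith [Real.exp_pos (-(α * γ / 5120 * w))]
    · rw [if_neg (not_not.2 hpath)]
      have h1 := bernP_ccl_lt_le hpath hb0 hkbℓ' hp₂0 hp₂1 hpbk
      rw [zero_add]
      refine le_trans (bernP_mono_ae (fun _ => hp₂0.le) (fun _ => hp₂1) fun ω₂ _ hω => ?_)
        (h1.trans (Real.exp_le_exp.2 hexp))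
      rw [hBad, boolGraph_or] at hω
      refine hω.trans_le ?_
      linarith
  have hunion : bernP (fun _ : Sym2 (Fin n) => p) (fun ω => Bad (boolGraph ω)) =
      bernE (fun _ => p₁) (fun ω₁ => bernP (fun _ => p₂)
        (fun ω₂ => Bad (boolGraph fun e => ω₁ e || ω₂ e))) := by
    have h := bernE_or (fun _ : Sym2 (Fin n) => p₁) (fun _ => p₂)
      (fun ω => @ite _ (Bad (boolGraph ω)) (Classical.propDecidable _) (1 : ℝ) 0)
    simp only [hp₂eq] at h
    exact h.symm
  change bernP (fun _ : Sym2 (Fin n) => p) (fun ω => Bad (boolGraph ω)) ≤ _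
  rw [hunion]
  refine (bernE_mono (fun _ => hp₁0) hp₁le hinner).trans (le_of_eq ?_)
  rw [bernE_add, bernE_const]
  rfl

end LowerBound

/-! ### Combining the two tail bounds -/

theorem theorem3 (c : ℝ) (hc : 1 < c) :
    ∃ δ : ℝ, 0 < δ ∧
      Filter.Tendsto
        (fun n : ℕ =>
          SimpleGraph.binomialRandom (Fin n) (SimpleGraph.sparseEdgeProb c n)
            {G : SimpleGraph (Fin n) |
              δ * Real.sqrt (n : ℝ) ≤ (SimpleGraph.ccl G : ℝ) ∧
                (SimpleGraph.ccl G : ℝ) ≤ 2 * Real.sqrt (c * (n : ℝ))})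
        Filter.atTop (nhds 1) := by
  obtain ⟨δ, hδ, hlow⟩ := tendsto_bernP_ccl_lt hc
  refine ⟨δ, hδ, ?_⟩
  have hup := tendsto_bernP_lt_ccl hc
  have hsum := hlow.add hup
  rw [add_zero] at hsum
  have hone : Filter.Tendsto (fun n : ℕ => ENNReal.ofReal (1 -
      (bernP (fun _ : Sym2 (Fin n) => c / (n : ℝ))
        (fun ω => ((boolGraph ω).ccl : ℝ) < δ * √(n : ℝ)) +
      bernP (fun _ : Sym2 (Fin n) => c / (n : ℝ))
        (fun ω => 2 * √(c * (n : ℝ)) < ((boolGraph ω).ccl : ℝ)))))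
      Filter.atTop (nhds 1) := by
    have h := ENNReal.tendsto_ofReal (hsum.const_sub 1)
    simpa using h
  refine tendsto_of_tendsto_of_tendsto_of_le_of_le' hone tendsto_const_nhds ?_
    (Filter.Eventually.of_forall fun n => MeasureTheory.prob_le_one)
  filter_upwards [tendsto_natCast_atTop_atTop.eventually_ge_atTop c] with n hn
  have hp0 : 0 ≤ c / (n : ℝ) := by positivity
  have hp1 : c / (n : ℝ) ≤ 1 := (div_le_one (by linarith)).2 hn
  -- Once `n ≥ c` the truncation to the unit interval has no effect.
  have hproj : ((SimpleGraph.sparseEdgeProb c n : unitInterval) : ℝ) = c / n := by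
    rw [SimpleGraph.sparseEdgeProb, Set.projIcc_of_mem zero_le_one ⟨hp0, hp1⟩]
  rw [binomialRandom_eq_ofReal_bernP, hproj]
  refine ENNReal.ofReal_le_ofReal ?_
  have h := bernP_or_le (fun _ : Sym2 (Fin n) => hp0) (fun _ => hp1)
    (fun ω => ((boolGraph ω).ccl : ℝ) < δ * √(n : ℝ))
    (fun ω => 2 * √(c * (n : ℝ)) < ((boolGraph ω).ccl : ℝ))
  rw [sub_le_comm, ← bernP_not]
  refine le_trans (bernP_mono_ae (fun _ => hp0) (fun _ => hp1) fun ω _ hω => ?_) h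
  by_contra hcon
  rw [not_or, not_lt, not_lt] at hcon
  exact hω hcon
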